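/- Let $E$ be a Polish space and let $(X_t,(\mathbb P_x)_{x\in E})$ be a conservative continuous-time (jointly measurable, time-homogeneous) Markov process on $E$ with semigroup $(P_t)_{t\ge 0}$ and invariant probability measure $\mu$. Let $L$, with domain $D(L)\subset \mathbb L^2(\mu)$, be the infinitesimal generator of $(P_t)$ on $\mathbb L^2(\mu)$, and write $\langle f,g\rangle_\mu=\int fg\,d\mu$ and $\mathbb P_\nu=\int \mathbb P_x\,\nu(dx)$. Call $F:\mathbb R^+\to\mathbb R$ *contractive* if $F(x)\to+\infty$ as $x\to+\infty$ and $G(x):=xF(x)$ is a normalised Young function: $G$ is convex and non-decreasing on $\mathbb R^+$, $G(0)=0$ and $G(1)+G^*(1)=1$, where $G^*(y)=\sup_{x\ge0}(xy-G(x))$. Put $N_{G^*}(V)=\inf\{u>0:\int G^*(|V|/u)\,d\mu\le G^*(1)\}\in[0,\infty]$. Assume that $F$ is contractive and that $\mu$ satisfies the strong $F$-Sobolev inequality with constant $C_{SF}>0$: for all $g\in D(L)$ with $\int g\,d\mu=0$ and $\int g^2\,d\mu=1$, $$\int g^2F(g^2)\,d\mu\le -C_{SF}\,\langle Lg,g\rangle_\mu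 .$$ Let $V$ satisfy $\int V\,d\mu=0$ and $\int V^2\,d\mu=m^2<+\infty$, and let $\nu$ be a probability measure absolutely continuous with respect to $\mu$. Then for all $t>0$ and $R>0$ the integral $\int_0^tV(X_s)\,ds$ is $\mathbb P_\nu$-almost surely well defined and $$\mathbb P_\nu\left(\frac1t\int_0^tV(X_s)\,ds\ge R\right)\le\left\|\frac{d\nu}{d\mu}\right\|_{\mathbb L^2(\mu)}\exp\left\{-t\sup_{0\le\lambda\le\lambda_2}\left(R\lambda-\frac{2m^2C_{SF}}{G(1)}\lambda^2\right)\right\},\qquad \lambda_2=\frac{G(1)}{2C_{SF}N_{G^*}(V)} .$$ Conventions: if $G(1)=0$ then $\lambda_2=0$ and the supremum is $0$; if $G(1)>0$, then $\lambda_2=0$ when $N_{G^*}(V)=\infty$, and $\lambda_2=\infty$ (all $\lambda\ge0$ allowed) when $N_{G^*}(V)=0$; $e^{-\infty}=0$ and $\infty\cdot 0=0$. -/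

import Mathlib

open MeasureTheory ProbabilityTheory Filter Topology
open scoped NNReal ENNReal

/-! ## Markov processes, their semigroups and their `L²` generators -/

/-- A conservative continuous-time Markov process `(X_t, (P_x)_{x ∈ E})` with state space `E`,
defined on `Ω`: `law x` is the probability `P_x`, under which the process starts at `x`, and the
(time-homogeneous) Markov property holds with respect to the natural filtration of `X`. -/
structure MarkovProcess (E Ω : Type*) [MeasurableSpace E] [MeasurableSpace Ω] where
  /-- The process, `X t ω` being the position at time `t`. -/
  X : ℝ≥0 → Ω → E
  /-- The probabilities `P_x`, depending measurably on `x`. -/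
  law : Kernel E Ω
  isMarkov_law : IsMarkovKernel law
  measurable_X : Measurable (fun p : ℝ≥0 × Ω => X p.1 p.2)
  map_X_zero : ∀ x : E, (law x).map (X 0) = Measure.dirac x
  markov : ∀ (x : E) (s t : ℝ≥0) (A : Set Ω) (B : Set E),
    MeasurableSet[⨆ u : ℝ≥0, ⨆ _ : u ≤ s, MeasurableSpace.comap (X u) inferInstance] A →
    MeasurableSet B →
    law x (A ∩ {ω | X (s + t) ω ∈ B}) = ∫⁻ ω in A, law (X s ω) {ω' | X t ω' ∈ B} ∂(law x)

namespace MarkovProcess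

variable {E Ω : Type*} [MeasurableSpace E] [MeasurableSpace Ω]

/-- The transition kernels, `transition t x B = P_x(X_t ∈ B)`. -/
noncomputable def transition (M : MarkovProcess E Ω) (t : ℝ≥0) : Kernel E E :=
  M.law.map (M.X t)

theorem measurable_X_at (M : MarkovProcess E Ω) (t : ℝ≥0) : Measurable (M.X t) :=
  M.measurable_X.comp measurable_prodMk_left

instance isMarkovKernel_transition (M : MarkovProcess E Ω) (t : ℝ≥0) :
    IsMarkovKernel (M.transition t) :=
  haveI := M.isMarkov_law
  Kernel.IsMarkovKernel.map _ (M.measurable_X_at t)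

/-- The transition semigroup, `(P_t f)(x) = E_x[f(X_t)]`. -/
noncomputable def semigroup (M : MarkovProcess E Ω) (t : ℝ≥0) (f : E → ℝ) (x : E) : ℝ :=
  ∫ y, f y ∂(M.transition t x)

/-- The law `P_ν = ∫ P_x ν(dx)` of the process with initial distribution `ν`. -/
noncomputable def initLaw (M : MarkovProcess E Ω) (ν : Measure E) : Measure Ω :=
  ν.bind M.law

/-- `μ` is invariant: `μ P_t = μ` for all `t ≥ 0`. -/
def IsInvariant (M : MarkovProcess E Ω) (μ : Measure E) : Prop :=
  ∀ t : ℝ≥0, (M.transition t).Invariant μ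

/-- `M.HasGenerator μ f h` says that `f` belongs to the domain `D(L)` of the infinitesimal
generator `L` of the semigroup `(P_t)` on `L²(μ)`, and that `L f = h`:
`f, h ∈ L²(μ)` and `(P_t f - f) / t → h` in `L²(μ)` as `t` decreases to `0`. -/
def HasGenerator (M : MarkovProcess E Ω) (μ : Measure E) (f h : E → ℝ) : Prop :=
  MemLp f 2 μ ∧ MemLp h 2 μ ∧
    Tendsto (fun t : ℝ≥0 =>
        eLpNorm (fun x => (t : ℝ)⁻¹ * (M.semigroup t f x - f x) - h x) 2 μ)
      (𝓝[>] 0) (𝓝 0)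

end MarkovProcess

/-! ## Contractive functions, Young functions and gauge norms -/

/-- The function `G(x) = x F(x)`; only its values on `[0, ∞)` matter. -/
def youngOf (F : ℝ → ℝ) (x : ℝ) : ℝ := x * F x

/-- The Fenchel-Legendre conjugate `G^*(y) = sup_{x ≥ 0} (x y - G(x))` of a function `G` on
`[0, ∞)`. The supremum is finite when `G(x) = x F(x)` with `F` contractive, see
`IsContractive.bddAbove_conj`. -/
noncomputable def youngConj (G : ℝ → ℝ) (y : ℝ) : ℝ := ⨆ x : ℝ≥0, ((x : ℝ) * y - G x)

/-- `F`, a function on `[0, ∞)`, is contractive: it tends to `+∞` at infinity, and `G(x) = x F(x)`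
is a normalised Young function, i.e. convex and non-decreasing on `[0, ∞)` with `G(0) = 0` and
`G(1) + G^*(1) = 1`. -/
structure IsContractive (F : ℝ → ℝ) : Prop where
  tendsto_atTop : Tendsto F atTop atTop
  convexOn : ConvexOn ℝ (Set.Ici 0) (youngOf F)
  monotoneOn : MonotoneOn (youngOf F) (Set.Ici 0)
  map_zero : youngOf F 0 = 0
  normalised : youngOf F 1 + youngConj (youngOf F) 1 = 1

theorem IsContractive.bddAbove_conj {F : ℝ → ℝ} (hF : IsContractive F) (y : ℝ) :
    BddAbove (Set.range fun x : ℝ≥0 => (x : ℝ) * y - youngOf F x) := by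
  obtain ⟨a, ha⟩ := (hF.tendsto_atTop.eventually_ge_atTop y).exists_forall_of_atTop
  refine ⟨|a| * |y|, ?_⟩
  rintro _ ⟨x, rfl⟩
  have hx : (0 : ℝ) ≤ x := x.2
  have hG : 0 ≤ youngOf F x := by
    have := hF.monotoneOn (Set.mem_Ici.2 le_rfl) (Set.mem_Ici.2 hx) hx
    rwa [hF.map_zero] at this
  rcases le_total a x with h | h
  · have h1 := mul_le_mul_of_nonneg_left (ha x h) hx
    have h2 : 0 ≤ |a| * |y| := by positivity
    simp only [youngOf]
    linarith
  · have h1 : (x : ℝ) * y ≤ |a| * |y| :=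
      (mul_le_mul_of_nonneg_left (le_abs_self y) hx).trans
        (mul_le_mul_of_nonneg_right (h.trans (le_abs_self a)) (abs_nonneg y))
    simp only
    linarith

/-- The gauge norm `N_Φ(f) = inf {u > 0 ; ∫ Φ(|f| / u) dμ ≤ Φ(1)} ∈ [0, ∞]` of a nonnegative
function `Φ` on `[0, ∞)`, with value `∞` if there is no such `u`. -/
noncomputable def gaugeNorm {E : Type*} [MeasurableSpace E] (Φ : ℝ → ℝ) (μ : Measure E)
    (f : E → ℝ) : ℝ≥0∞ :=
  ⨅ (u : ℝ) (_ : 0 < u) (_ : ∫⁻ x, ENNReal.ofReal (Φ (|f x| / u)) ∂μ ≤ ENNReal.ofReal (Φ 1)),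
    ENNReal.ofReal u

/-! ## The functional inequality -/

/-- `μ` satisfies the strong `F`-Sobolev inequality with constant `C`: for all `g ∈ D(L)` with
`∫ g dμ = 0` and `∫ g² dμ = 1`, `∫ g² F(g²) dμ ≤ - C ⟨L g, g⟩_μ` (in particular the left-hand
side is finite). Here `h` stands for `L g`. -/
def StrongFSobolev {E Ω : Type*} [MeasurableSpace E] [MeasurableSpace Ω]
    (M : MarkovProcess E Ω) (μ : Measure E) (F : ℝ → ℝ) (C : ℝ) : Prop :=
  ∀ g h : E → ℝ, M.HasGenerator μ g h → ∫ x, g x ∂μ = 0 → ∫ x, g x ^ 2 ∂μ = 1 →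
    Integrable (fun x => g x ^ 2 * F (g x ^ 2)) μ ∧
      ∫ x, g x ^ 2 * F (g x ^ 2) ∂μ ≤ -C * ∫ x, h x * g x ∂μ

/-- The threshold `λ₂ = G(1) / (2 C N_{G^*}(V)) ∈ [0, ∞]`, where `G(x) = x F(x)`. -/
noncomputable def lambdaTwo {E : Type*} [MeasurableSpace E] (F : ℝ → ℝ) (C : ℝ) (μ : Measure E)
    (V : E → ℝ) : ℝ≥0∞ :=
  ENNReal.ofReal (youngOf F 1) /
    (2 * ENNReal.ofReal C * gaugeNorm (youngConj (youngOf F)) μ V)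

/-- The rate `sup_{0 ≤ l ≤ λ₂} (R l - (2 m² C / G(1)) l²) ∈ [0, ∞]`. -/
noncomputable def deviationRate (G₁ C m R : ℝ) (l₂ : ℝ≥0∞) : EReal :=
  ⨆ (l : ℝ) (_ : 0 ≤ l ∧ ENNReal.ofReal l ≤ l₂),
    ((R * l - (2 * m ^ 2 * C / G₁) * l ^ 2 : ℝ) : EReal)

/-!
For bounded `W`, the Feynman–Kac functional `u_t(x) = E_x[exp(∫_0^t W(X_s) ds)]` lies in the domain
of the generator, `∂_t u = L u + W u`, and a form bound `⟨W g, g⟩ + ⟨L g, g⟩ ≤ Λ ‖g‖²` gives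
`‖u_t‖₂ ≤ exp(Λ t)` by Grönwall's inequality. Cauchy–Schwarz against `dν/dμ` and Chernoff's bound
turn this into a deviation inequality.

For the form bound with `W = l V`, write `g = a + h` with `a` the mean of `g`. When `‖h‖ = 1`,
Young's inequality `x ≤ G(x) + G^*(1)` gives `G(1) ≤ ∫ G(h²) dμ`, so that the strong `F`-Sobolev
inequality contains the Poincaré inequality `G(1) ‖h‖² ≤ -C ⟨L h, h⟩`; applied to `|V| h²` it gives
`G(1) ∫ |V| h² dμ ≤ -C N_{G^*}(V) ⟨L h, h⟩`. The condition `l ≤ λ₂` says that half of the energy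
absorbs `l ∫ |V| h² dμ`; the other half absorbs, through the Poincaré inequality, the cross term
`2 a l ∫ V h dμ`, at the cost of `Λ = 2 m² C l² / G(1)`. Unbounded `V` are reached by truncation and
Fatou's lemma. If `dν/dμ` is not in `L²(μ)`, only the case where the exponential factor vanishes is
at stake, and it follows from the bound for `ν = μ`.
-/

/-! ## Real analysis -/

theorem absolutelyContinuousOnInterval_comp {Y Z : Type*} [PseudoMetricSpace Y]
    [PseudoMetricSpace Z] {Φ : Y → Z} {f : ℝ → Y} {K : ℝ≥0} {a b : ℝ}
    (hΦ : LipschitzOnWith K Φ (f '' Set.uIcc a b)) (hf : AbsolutelyContinuousOnInterval f a b) :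
    AbsolutelyContinuousOnInterval (Φ ∘ f) a b := by
  have hlim := Tendsto.const_mul (K : ℝ) hf
  rw [mul_zero] at hlim
  refine squeeze_zero' (Eventually.of_forall fun I => Finset.sum_nonneg fun _ _ => dist_nonneg)
    ?_ hlim
  filter_upwards [mem_inf_of_right (mem_principal_self _)] with I hI
  rw [Finset.mul_sum]
  exact Finset.sum_le_sum fun i hi => hΦ.dist_le_mul _
    (Set.mem_image_of_mem f (hI.1 i hi).1) _ (Set.mem_image_of_mem f (hI.1 i hi).2)

theorem comp_add_intervalIntegral_sub {Φ g : ℝ → ℝ} (hΦ : ContDiff ℝ 1 Φ) {a b : ℝ}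
    (hg : IntervalIntegrable g volume a b) (c : ℝ) :
    Φ (c + ∫ s in a..b, g s) - Φ c = ∫ t in a..b, deriv Φ (c + ∫ s in a..t, g s) * g t := by
  set J : ℝ → ℝ := fun t => c + ∫ s in a..t, g s with hJ
  have hJ_ac : AbsolutelyContinuousOnInterval J a b :=
    ((LipschitzWith.const c).lipschitzOnWith.absolutelyContinuousOnInterval (K := 0)).fun_add
      (hg.absolutelyContinuousOnInterval_intervalIntegral Set.left_mem_uIcc)
  have hJ_cont : ContinuousOn J (Set.uIcc a b) := hJ_ac.continuousOn
  obtain ⟨K, hK⟩ := (hΦ.contDiffOn (s := J '' Set.uIcc a b)).exists_lipschitzOnWith one_ne_zero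
    (isPreconnected_uIcc.image J hJ_cont).ordConnected.convex
    (isCompact_uIcc.image_of_continuousOn hJ_cont)
  have hderiv : ∀ᵐ t, t ∈ Set.uIoc a b → deriv (Φ ∘ J) t = deriv Φ (J t) * g t := by
    filter_upwards [hg.ae_hasDerivAt_integral] with t ht htab
    have hJ_deriv : HasDerivAt J (g t) t :=
      (ht (Set.uIoc_subset_uIcc htab) a Set.left_mem_uIcc).const_add c
    exact ((hΦ.differentiable one_ne_zero (J t)).hasDerivAt.comp t hJ_deriv).deriv
  have hFTC := (absolutelyContinuousOnInterval_comp hK hJ_ac).integral_deriv_eq_sub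
  rw [intervalIntegral.integral_congr_ae hderiv] at hFTC
  simpa [hJ] using hFTC.symm

theorem tendsto_integral_norm_translate_sub {F : Type*} [NormedAddCommGroup F] {g : ℝ → F}
    (hg : Integrable g) : Tendsto (fun h : ℝ => ∫ s, ‖g (h + s) - g s‖) (𝓝 0) (𝓝 0) := by
  have : Fact ((1 : ℝ≥0∞) ≠ ∞) := ⟨ENNReal.one_ne_top⟩
  have hcont : Continuous fun h : ℝ => ‖(DomAddAct.mk h +ᵥ hg.toL1 g) - hg.toL1 g‖ :=
    ((DomAddAct.continuous_mk.vadd continuous_const).sub continuous_const).norm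
  refine (hcont.tendsto' 0 0 (by simp)).congr fun h => ?_
  rw [L1.norm_eq_integral_norm]
  have htrans : (fun s => hg.toL1 g (h + s)) =ᵐ[volume] fun s => g (h + s) :=
    (measurePreserving_add_left volume h).quasiMeasurePreserving.ae_eq_comp hg.coeFn_toL1
  refine integral_congr_ae ?_
  filter_upwards [DomAddAct.vadd_Lp_ae_eq (DomAddAct.mk h) (hg.toL1 g), hg.coeFn_toL1, htrans,
    Lp.coeFn_sub (DomAddAct.mk h +ᵥ hg.toL1 g) (hg.toL1 g)] with s hs hgs hgs' hsub
  rw [hsub, Pi.sub_apply, hs, hgs, ← hgs']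
  rfl

theorem tendsto_intervalIntegral_norm_translate_sub {F : Type*} [NormedAddCommGroup F] {g : ℝ → F}
    (hg : LocallyIntegrable g) {a b : ℝ} (hab : a ≤ b) :
    Tendsto (fun h : ℝ => ∫ s in a..b, ‖g (h + s) - g s‖) (𝓝 0) (𝓝 0) := by
  set G : ℝ → F := (Set.Icc (a - 1) (b + 1)).indicator g
  have hG : Integrable G :=
    (integrable_indicator_iff measurableSet_Icc).2 (hg.integrableOn_isCompact isCompact_Icc)
  have hgG {s : ℝ} (hs : s ∈ Set.Icc (a - 1) (b + 1)) : g s = G s :=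
    (Set.indicator_of_mem hs g).symm
  refine squeeze_zero' (Eventually.of_forall fun h =>
    intervalIntegral.integral_nonneg hab fun _ _ => norm_nonneg _) ?_
    (tendsto_integral_norm_translate_sub hG)
  filter_upwards [Icc_mem_nhds neg_one_lt_zero zero_lt_one] with h hh
  calc ∫ s in a..b, ‖g (h + s) - g s‖ = ∫ s in a..b, ‖G (h + s) - G s‖ := by
        refine intervalIntegral.integral_congr fun s hs => ?_
        rw [Set.uIcc_of_le hab] at hs
        simp only [hgG (s := h + s) ⟨by linarith [hs.1, hh.1], by linarith [hs.2, hh.2]⟩,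
          hgG (s := s) ⟨by linarith [hs.1], by linarith [hs.2]⟩]
    _ ≤ ∫ s, ‖G (h + s) - G s‖ := by
        rw [intervalIntegral.integral_of_le hab]
        exact setIntegral_le_integral ((hG.comp_add_left h).sub hG).norm
          (Eventually.of_forall fun _ => norm_nonneg _)

theorem le_mul_exp_of_le_add_mul_integral {φ : ℝ → ℝ} (hφ : Continuous φ) {A L T : ℝ} (hL : 0 ≤ L)
    (hT : 0 ≤ T) (h : ∀ t ∈ Set.Icc 0 T, φ t ≤ A + L * ∫ s in (0 : ℝ)..t, φ s) :
    φ T ≤ A * Real.exp (L * T) := by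
  set Ψ : ℝ → ℝ := fun t => A + L * ∫ s in (0 : ℝ)..t, φ s with hΨ
  have hΨ_deriv (t : ℝ) : HasDerivAt Ψ (L * φ t) t :=
    ((hφ.integral_hasStrictDerivAt 0 t).hasDerivAt.const_mul L).const_add A
  have hbound := le_gronwallBound_of_liminf_deriv_right_le (f := Ψ) (f' := fun t => L * φ t)
    (δ := A) (K := L) (ε := 0) (a := 0) (b := T)
    (fun t _ => (hΨ_deriv t).continuousAt.continuousWithinAt)
    (fun t _ r hr => (hΨ_deriv t).hasDerivWithinAt.liminf_right_slope_le hr) (by simp [hΨ])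
    (fun t ht => by
      simpa using mul_le_mul_of_nonneg_left (h t (Set.Ico_subset_Icc_self ht)) hL)
    T (Set.right_mem_Icc.2 hT)
  rw [sub_zero, gronwallBound_ε0] at hbound
  exact (h T (Set.right_mem_Icc.2 hT)).trans hbound

theorem abs_inv_mul_exp_sub_one_sub_le {h a d : ℝ} (hh : 0 ≤ h) (ha : |a| ≤ 1) :
    |h⁻¹ * (Real.exp a - 1) - d| ≤ h⁻¹ * a ^ 2 + |h⁻¹ * a - d| := by
  have hrem : |h⁻¹ * (Real.exp a - 1 - a)| ≤ h⁻¹ * a ^ 2 := by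
    rw [abs_mul, abs_of_nonneg (inv_nonneg.2 hh)]
    exact mul_le_mul_of_nonneg_left (Real.abs_exp_sub_one_sub_id_le ha) (inv_nonneg.2 hh)
  calc |h⁻¹ * (Real.exp a - 1) - d| = |h⁻¹ * (Real.exp a - 1 - a) + (h⁻¹ * a - d)| := by ring_nf
    _ ≤ |h⁻¹ * (Real.exp a - 1 - a)| + |h⁻¹ * a - d| := abs_add_le _ _
    _ ≤ h⁻¹ * a ^ 2 + |h⁻¹ * a - d| := by gcongr

theorem mul_sq_le_add_of_pos {c : ℝ} (hc : 0 < c) (w a y : ℝ) :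
    w * y ^ 2 ≤ a ^ 2 * w + a ^ 2 * (c⁻¹ * w ^ 2) + (c * (y - a) ^ 2 + |w| * (y - a) ^ 2) := by
  -- AM-GM for the cross term `2 a w (y - a)` in the expansion of `w (a + (y - a)) ^ 2`
  have hcross : 2 * (a * w) * (y - a) ≤ a ^ 2 * (c⁻¹ * w ^ 2) + c * (y - a) ^ 2 := by
    have hsq : 0 ≤ c⁻¹ * (a * w - c * (y - a)) ^ 2 := by positivity
    have hexpand : c⁻¹ * (a * w - c * (y - a)) ^ 2 =
        a ^ 2 * (c⁻¹ * w ^ 2) + c * (y - a) ^ 2 - 2 * (a * w) * (y - a) := by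
      field_simp
      ring
    linarith
  have habs : w * (y - a) ^ 2 ≤ |w| * (y - a) ^ 2 := by gcongr; exact le_abs_self w
  linarith [show w * y ^ 2 = a ^ 2 * w + 2 * (a * w) * (y - a) + w * (y - a) ^ 2 by ring]

/-! ## Measure theory -/

section MeasureTheoryLemmas

variable {α β S : Type*} [MeasurableSpace α] [MeasurableSpace β] [MeasurableSpace S]

theorem integral_bind_kernel {Q : Measure α} [SFinite Q] {κ : Kernel α β} [IsSFiniteKernel κ]
    {f : β → ℝ} (hf : Integrable f (Q.bind κ)) :
    ∫ y, f y ∂(Q.bind κ) = ∫ x, ∫ y, f y ∂(κ x) ∂Q := by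
  rw [Measure.comp_eq_comp_const_apply] at hf ⊢
  simpa using Kernel.integral_comp hf

theorem integrable_integral_kernel {Q : Measure α} [SFinite Q] {κ : Kernel α β} [IsSFiniteKernel κ]
    {f : β → ℝ} (hf : Integrable f (Q.bind κ)) : Integrable (fun x => ∫ y, f y ∂(κ x)) Q := by
  rw [Measure.comp_eq_comp_const_apply] at hf
  simpa using hf.integral_comp

theorem measurable_integral_kernel_prod {κ : Kernel α β} [IsSFiniteKernel κ] {F : S × β → ℝ}
    (hF : Measurable F) : Measurable fun p : S × α => ∫ y, F (p.1, y) ∂(κ p.2) := by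
  have hF' : Measurable fun q : (S × α) × β => F (q.1.1, q.2) := hF.comp (by fun_prop)
  simpa using (hF'.stronglyMeasurable.integral_kernel_prod_right' (κ := κ.prodMkLeft S)).measurable

theorem measurable_intervalIntegral {F : ℝ × α → ℝ} (hF : Measurable F) {u v : α → ℝ}
    (hu : Measurable u) (hv : Measurable v) :
    Measurable fun x => ∫ r in u x..v x, F (r, x) := by
  have hIoc {u v : α → ℝ} (hu : Measurable u) (hv : Measurable v) :
      Measurable fun x => ∫ r in Set.Ioc (u x) (v x), F (r, x) := by
    have hs : MeasurableSet {q : α × ℝ | q.2 ∈ Set.Ioc (u q.1) (v q.1)} :=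
      (measurableSet_lt (by fun_prop) measurable_snd).inter
        (measurableSet_le measurable_snd (by fun_prop))
    simp only [← integral_indicator measurableSet_Ioc]
    exact ((hF.comp measurable_swap).indicator hs).stronglyMeasurable.integral_prod_right'
      (ν := volume) |>.measurable
  exact (hIoc hu hv).sub (hIoc hv hu)

theorem integral_intervalIntegral_swap {Q : Measure α} [IsFiniteMeasure Q] {F : ℝ × α → ℝ}
    (hF : Measurable F) {B a b : ℝ} (hB : ∀ r ∈ Set.uIoc a b, ∀ x, ‖F (r, x)‖ ≤ B) :
    ∫ x, (∫ r in a..b, F (r, x)) ∂Q = ∫ r in a..b, (∫ x, F (r, x) ∂Q) := by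
  have : IsFiniteMeasure (volume.restrict (Set.uIoc a b)) := ⟨by simp⟩
  refine (intervalIntegral_integral_swap (f := fun r x => F (r, x))
    (Integrable.of_bound hF.aestronglyMeasurable B ?_)).symm
  filter_upwards [(Measure.quasiMeasurePreserving_fst (ν := Q)).ae
    (ae_restrict_mem (measurableSet_uIoc (a := a) (b := b)))] with p hp using hB _ hp _

theorem integral_pow_integral_swap {Q : Measure α} [IsFiniteMeasure Q] {ρ : Measure β}
    [IsFiniteMeasure ρ] {F : β × α → ℝ} (hF : Measurable F) {B : ℝ} (hB : ∀ p, ‖F p‖ ≤ B) (n : ℕ) :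
    ∫ x, (∫ r, F (r, x) ∂ρ) ^ n ∂Q =
      ∫ r : Fin n → β, ∫ x, ∏ i, F (r i, x) ∂Q ∂(Measure.pi fun _ => ρ) := by
  have hpow (x : α) : (∫ r, F (r, x) ∂ρ) ^ n =
      ∫ r : Fin n → β, ∏ i, F (r i, x) ∂(Measure.pi fun _ => ρ) := by
    simpa using (integral_fintype_prod_eq_pow (ι := Fin n) (fun r => F (r, x)) (μ := ρ)).symm
  simp only [hpow]
  refine integral_integral_swap (Integrable.of_bound (C := B ^ n) ?_ (Eventually.of_forall ?_))
  · exact (Finset.measurable_fun_prod _ fun i _ => hF.comp (by fun_prop)).aestronglyMeasurable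
  · intro p
    simpa [Function.uncurry, norm_prod] using
      Finset.prod_le_prod (s := Finset.univ) (fun i _ => norm_nonneg (F (p.2 i, p.1)))
        fun i _ => hB _

theorem intervalIntegrable_of_norm_le {g : ℝ → ℝ} (hg : Measurable g) {B a b : ℝ}
    (hB : ∀ s ∈ Set.uIoc a b, ‖g s‖ ≤ B) : IntervalIntegrable g volume a b :=
  intervalIntegrable_iff.2 <| IntegrableOn.of_bound (by simp) hg.aestronglyMeasurable B
    (ae_restrict_of_forall_mem measurableSet_uIoc hB)

theorem integral_exp_eq_tsum {Q : Measure α} [IsFiniteMeasure Q] {f : α → ℝ}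
    (hf : AEStronglyMeasurable f Q) {B : ℝ} (hB : ∀ x, ‖f x‖ ≤ B) :
    ∫ x, Real.exp (f x) ∂Q = ∑' n : ℕ, (n.factorial : ℝ)⁻¹ * ∫ x, f x ^ n ∂Q := by
  have hterm (n : ℕ) (x : α) : ‖(n.factorial : ℝ)⁻¹ * f x ^ n‖ ≤ B ^ n / n.factorial := by
    rw [norm_mul, norm_pow, norm_inv, Real.norm_natCast, div_eq_inv_mul]
    gcongr
    exact hB x
  have hint (n : ℕ) : Integrable (fun x => (n.factorial : ℝ)⁻¹ * f x ^ n) Q :=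
    Integrable.of_bound ((hf.pow n).const_mul _) _ (Eventually.of_forall (hterm n))
  have hsum : Summable fun n : ℕ => ∫ x, ‖(n.factorial : ℝ)⁻¹ * f x ^ n‖ ∂Q := by
    refine Summable.of_nonneg_of_le (fun n => integral_nonneg fun _ => norm_nonneg _)
      (fun n => ?_) ((Real.summable_pow_div_factorial B).mul_left (Q.real Set.univ))
    refine (integral_mono_of_nonneg (Eventually.of_forall fun _ => norm_nonneg _)
      (integrable_const _) (Eventually.of_forall (hterm n))).trans_eq ?_
    rw [integral_const, smul_eq_mul]
  have hexp (y : ℝ) : Real.exp y = ∑' n : ℕ, (n.factorial : ℝ)⁻¹ * y ^ n := by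
    simp only [Real.exp_eq_exp_ℝ, NormedSpace.exp_eq_tsum ℝ, smul_eq_mul]
  simp only [hexp]
  rw [← integral_tsum_of_summable_integral_norm hint hsum]
  simp only [integral_const_mul]

theorem eLpNorm_two_le_sqrt_mul_integral_norm {Q : Measure α} [IsFiniteMeasure Q] {g : α → ℝ}
    (hg : AEStronglyMeasurable g Q) {B : ℝ} (hB : ∀ x, ‖g x‖ ≤ B) :
    eLpNorm g 2 Q ≤ ENNReal.ofReal (Real.sqrt (B * ∫ x, ‖g x‖ ∂Q)) := by
  have hg2 : MemLp g 2 Q := MemLp.of_bound hg B (Eventually.of_forall hB)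
  rw [hg2.eLpNorm_eq_integral_rpow_norm two_ne_zero ENNReal.ofNat_ne_top, Real.sqrt_eq_rpow]
  simp only [ENNReal.toReal_ofNat, Real.rpow_ofNat, one_div]
  gcongr
  rw [← integral_const_mul]
  refine integral_mono_of_nonneg (Eventually.of_forall fun x => sq_nonneg _)
    ((Integrable.of_bound hg B (Eventually.of_forall hB)).norm.const_mul B)
    (Eventually.of_forall fun x => ?_)
  simpa only [sq] using mul_le_mul_of_nonneg_right (hB x) (norm_nonneg (g x))

theorem lintegral_le_eLpNorm_rnDeriv_mul {μ ν : Measure α} [SigmaFinite μ] [SigmaFinite ν]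
    (hν : ν ≪ μ) {f : α → ℝ≥0∞} (hf : Measurable f) :
    ∫⁻ x, f x ∂ν ≤ eLpNorm (ν.rnDeriv μ) 2 μ * (∫⁻ x, f x ^ (2 : ℝ) ∂μ) ^ (1 / 2 : ℝ) := by
  rw [← lintegral_rnDeriv_mul hν hf.aemeasurable,
    eLpNorm_eq_lintegral_rpow_enorm_toReal two_ne_zero ENNReal.ofNat_ne_top]
  simpa using ENNReal.lintegral_mul_le_Lp_mul_Lq μ Real.HolderConjugate.two_two
    (Measure.measurable_rnDeriv ν μ).aemeasurable hf.aemeasurable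

theorem one_le_eLpNorm_rnDeriv {μ ν : Measure α} [IsProbabilityMeasure μ] [IsProbabilityMeasure ν]
    (hν : ν ≪ μ) : 1 ≤ eLpNorm (ν.rnDeriv μ) 2 μ := by
  simpa using lintegral_le_eLpNorm_rnDeriv_mul hν (f := fun _ => 1) measurable_const

theorem integral_mul_sq_le_add {μ : Measure α} [IsFiniteMeasure μ] {U g : α → ℝ}
    (hU : Measurable U) {K : ℝ} (hK : ∀ x, ‖U x‖ ≤ K) {c : ℝ} (hc : 0 < c) (hg : MemLp g 2 μ)
    (a : ℝ) :
    ∫ x, U x * g x ^ 2 ∂μ ≤ a ^ 2 * ∫ x, U x ∂μ + a ^ 2 * (c⁻¹ * ∫ x, U x ^ 2 ∂μ) +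
      (c * ∫ x, (g x - a) ^ 2 ∂μ + ∫ x, |U x| * (g x - a) ^ 2 ∂μ) := by
  have hUp : MemLp U 2 μ := MemLp.of_bound hU.aestronglyMeasurable K (Eventually.of_forall hK)
  have hsq : Integrable (fun x => (g x - a) ^ 2) μ := (hg.sub (memLp_const a)).integrable_sq
  have hmean : Integrable (fun x => a ^ 2 * U x) μ := (hUp.integrable one_le_two).const_mul _
  have hsquare : Integrable (fun x => a ^ 2 * (c⁻¹ * U x ^ 2)) μ :=
    (hUp.integrable_sq.const_mul _).const_mul _
  have hcentred : Integrable (fun x => c * (g x - a) ^ 2) μ := hsq.const_mul c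
  have hpotential : Integrable (fun x => |U x| * (g x - a) ^ 2) μ :=
    hsq.bdd_mul hU.abs.aestronglyMeasurable (Eventually.of_forall fun x => by simpa using hK x)
  have hmono := integral_mono
    (hg.integrable_sq.bdd_mul hU.aestronglyMeasurable (Eventually.of_forall hK))
    ((hmean.add hsquare).add (hcentred.add hpotential))
    fun x => mul_sq_le_add_of_pos hc (U x) a (g x)
  rw [integral_add' (hmean.add hsquare) (hcentred.add hpotential), integral_add' hmean hsquare,
    integral_add' hcentred hpotential] at hmono
  simpa only [integral_const_mul] using hmono

theorem eLpNorm_rnDeriv_self {μ : Measure α} [IsProbabilityMeasure μ] :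
    eLpNorm (μ.rnDeriv μ) 2 μ = 1 := by
  rw [eLpNorm_congr_ae (Measure.rnDeriv_self μ)]
  simpa using eLpNorm_const (1 : ℝ≥0∞) two_ne_zero (NeZero.ne μ)

theorem measure_ge_le_mul_lintegral_exp {P : Measure α} {Y : α → ℝ} (hY : Measurable Y) {l : ℝ}
    (hl : 0 ≤ l) (r : ℝ) :
    P {x | r ≤ Y x} ≤
      (∫⁻ x, ENNReal.ofReal (Real.exp (l * Y x)) ∂P) * ENNReal.ofReal (Real.exp (-(l * r))) := by
  have hpos := Real.exp_pos (l * r)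
  have hinv : ENNReal.ofReal (Real.exp (-(l * r))) = (ENNReal.ofReal (Real.exp (l * r)))⁻¹ := by
    rw [Real.exp_neg, ENNReal.ofReal_inv_of_pos hpos]
  rw [hinv, ← div_eq_mul_inv]
  calc P {x | r ≤ Y x}
      ≤ P {x | ENNReal.ofReal (Real.exp (l * r)) ≤ ENNReal.ofReal (Real.exp (l * Y x))} :=
        measure_mono fun x (hx : r ≤ Y x) => ENNReal.ofReal_le_ofReal (by gcongr)
    _ ≤ _ := meas_ge_le_lintegral_div (by fun_prop) (by simpa using hpos) ENNReal.ofReal_ne_top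

end MeasureTheoryLemmas

namespace MarkovProcess

variable {E Ω : Type*} [MeasurableSpace E] {mΩ : MeasurableSpace Ω}

/-! ## The Markov property under an arbitrary initial law -/

instance isMarkovKernel_law (M : MarkovProcess E Ω) : IsMarkovKernel M.law := M.isMarkov_law

instance isFiniteMeasure_initLaw (M : MarkovProcess E Ω) (ν : Measure E) [IsFiniteMeasure ν] :
    IsFiniteMeasure (M.initLaw ν) := by
  unfold initLaw; infer_instance

instance isProbabilityMeasure_initLaw (M : MarkovProcess E Ω) (ν : Measure E)
    [IsProbabilityMeasure ν] : IsProbabilityMeasure (M.initLaw ν) := by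
  unfold initLaw; infer_instance

theorem initLaw_dirac (M : MarkovProcess E Ω) (x : E) :
    M.initLaw (Measure.dirac x) = M.law x :=
  Measure.dirac_bind M.law.measurable x

theorem map_X_law (M : MarkovProcess E Ω) (t : ℝ≥0) (x : E) :
    (M.law x).map (M.X t) = M.transition t x :=
  (Kernel.map_apply _ (M.measurable_X_at t) x).symm

theorem map_X_initLaw (M : MarkovProcess E Ω) (t : ℝ≥0) (ν : Measure E) :
    (M.initLaw ν).map (M.X t) = ν.bind (M.transition t) :=
  Measure.map_comp ν M.law (M.measurable_X_at t)

theorem bind_transition_zero (M : MarkovProcess E Ω) (ν : Measure E) :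
    ν.bind (M.transition 0) = ν := by
  have htransition : M.transition 0 = Kernel.id := by
    ext1 x
    rw [← map_X_law, M.map_X_zero, Kernel.id_apply]
  rw [htransition, Measure.id_comp]

/-- The `σ`-algebra generated by the process up to time `s`. -/
@[reducible]
def past (M : MarkovProcess E Ω) (s : ℝ≥0) : MeasurableSpace Ω :=
  ⨆ u : ℝ≥0, ⨆ _ : u ≤ s, MeasurableSpace.comap (M.X u) inferInstance

theorem past_le (M : MarkovProcess E Ω) (s : ℝ≥0) : M.past s ≤ mΩ :=
  iSup₂_le fun u _ => (M.measurable_X_at u).comap_le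

theorem measurable_X_past (M : MarkovProcess E Ω) {u s : ℝ≥0} (hus : u ≤ s) :
    Measurable[M.past s] (M.X u) :=
  measurable_iff_comap_le.2 (le_iSup₂_of_le u hus le_rfl)

theorem initLaw_inter_preimage_X (M : MarkovProcess E Ω) (ν : Measure E) {s t : ℝ≥0} {A : Set Ω}
    (hA : MeasurableSet[M.past s] A) {B : Set E} (hB : MeasurableSet B) :
    M.initLaw ν (A ∩ M.X (s + t) ⁻¹' B) = ∫⁻ ω in A, M.transition t (M.X s ω) B ∂(M.initLaw ν) := by
  have hA' : MeasurableSet A := M.past_le s A hA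
  have hmeas : Measurable fun ω => M.transition t (M.X s ω) B :=
    ((M.transition t).measurable_coe hB).comp (M.measurable_X_at s)
  rw [initLaw,
    Measure.bind_apply (hA'.inter (M.measurable_X_at _ hB)) M.law.measurable.aemeasurable,
    ← lintegral_indicator hA', Measure.lintegral_bind M.law.measurable.aemeasurable
      (hmeas.indicator hA').aemeasurable]
  refine lintegral_congr fun x => ?_
  rw [lintegral_indicator hA']
  refine (M.markov x s t A B hA hB).trans (lintegral_congr fun ω => ?_)
  rw [← map_X_law, Measure.map_apply (M.measurable_X_at t) hB]
  rfl

theorem setLIntegral_comp_X (M : MarkovProcess E Ω) (ν : Measure E) {s t : ℝ≥0} {A : Set Ω}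
    (hA : MeasurableSet[M.past s] A) {f : E → ℝ≥0∞} (hf : Measurable f) :
    ∫⁻ ω in A, f (M.X (s + t) ω) ∂(M.initLaw ν) =
      ∫⁻ ω in A, ∫⁻ y, f y ∂(M.transition t (M.X s ω)) ∂(M.initLaw ν) := by
  have hlaw : ((M.initLaw ν).restrict A).map (M.X (s + t)) =
      (((M.initLaw ν).restrict A).map (M.X s)).bind (M.transition t) := by
    ext B hB
    rw [Measure.map_apply (M.measurable_X_at _) hB,
      Measure.restrict_apply (M.measurable_X_at _ hB), Set.inter_comm,
      M.initLaw_inter_preimage_X ν hA hB,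
      Measure.bind_apply hB (M.transition t).measurable.aemeasurable,
      lintegral_map ((M.transition t).measurable_coe hB) (M.measurable_X_at s)]
  rw [← lintegral_map hf (M.measurable_X_at _), hlaw,
    Measure.lintegral_bind (M.transition t).measurable.aemeasurable hf.aemeasurable,
    lintegral_map hf.lintegral_kernel (M.measurable_X_at s)]

theorem lintegral_mul_comp_X (M : MarkovProcess E Ω) (ν : Measure E) {s t : ℝ≥0} {Z : Ω → ℝ≥0∞}
    (hZ : Measurable[M.past s] Z) {f : E → ℝ≥0∞} (hf : Measurable f) :
    ∫⁻ ω, Z ω * f (M.X (s + t) ω) ∂(M.initLaw ν) =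
      ∫⁻ ω, Z ω * ∫⁻ y, f y ∂(M.transition t (M.X s ω)) ∂(M.initLaw ν) := by
  have hfX : Measurable fun ω => f (M.X (s + t) ω) := hf.comp (M.measurable_X_at _)
  have hPfX : Measurable fun ω => ∫⁻ y, f y ∂(M.transition t (M.X s ω)) :=
    hf.lintegral_kernel.comp (M.measurable_X_at s)
  have htrim : ((M.initLaw ν).withDensity fun ω => f (M.X (s + t) ω)).trim (M.past_le s) =
      ((M.initLaw ν).withDensity fun ω => ∫⁻ y, f y ∂(M.transition t (M.X s ω))).trim
        (M.past_le s) := by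
    refine @Measure.ext _ (M.past s) _ _ fun A hA => ?_
    rw [trim_measurableSet_eq _ hA, trim_measurableSet_eq _ hA,
      withDensity_apply _ (M.past_le s A hA), withDensity_apply _ (M.past_le s A hA)]
    exact M.setLIntegral_comp_X ν hA hf
  have hZ' : Measurable Z := hZ.mono (M.past_le s) le_rfl
  simp only [mul_comm (Z _)]
  have hmul {ρ : Ω → ℝ≥0∞} (hρ : Measurable ρ) :
      ∫⁻ ω, ρ ω * Z ω ∂(M.initLaw ν) =
        ∫⁻ ω, Z ω ∂(((M.initLaw ν).withDensity ρ).trim (M.past_le s)) := by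
    rw [lintegral_trim _ hZ, lintegral_withDensity_eq_lintegral_mul _ hρ hZ']
    rfl
  rw [hmul hfX, hmul hPfX, htrim]

theorem lintegral_prod_insert_mul_comp_X (M : MarkovProcess E Ω) (ρ : Measure E) (r : ℝ≥0)
    {f : ℝ≥0 → E → ℝ≥0∞} (hf : ∀ i, Measurable (f i)) {I : Finset ℝ≥0} {t s : ℝ≥0}
    (hI : ∀ i ∈ I, i < t) (hts : t ≤ s) {g : E → ℝ≥0∞} (hg : Measurable g) :
    ∫⁻ ω, (∏ i ∈ insert t I, f i (M.X (r + i) ω)) * g (M.X (r + s) ω) ∂(M.initLaw ρ) =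
      ∫⁻ ω, (∏ i ∈ I, f i (M.X (r + i) ω)) *
        (f t (M.X (r + t) ω) * ∫⁻ y, g y ∂(M.transition (s - t) (M.X (r + t) ω)))
        ∂(M.initLaw ρ) := by
  have hmeas : Measurable[M.past (r + t)] fun ω => ∏ i ∈ insert t I, f i (M.X (r + i) ω) :=
    Finset.measurable_fun_prod _ fun i hi => (hf i).comp (M.measurable_X_past (by
      rcases Finset.mem_insert.1 hi with rfl | hi
      · exact le_rfl
      · exact add_le_add_right (hI i hi).le r))
  have hmarkov := M.lintegral_mul_comp_X ρ (t := s - t) hmeas hg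
  rw [add_assoc, add_tsub_cancel_of_le hts] at hmarkov
  rw [hmarkov]
  refine lintegral_congr fun ω => ?_
  rw [Finset.prod_insert fun ht => lt_irrefl t (hI t ht)]
  ring

theorem lintegral_prod_comp_X_add (M : MarkovProcess E Ω) (ν : Measure E) (h : ℝ≥0)
    {f : ℝ≥0 → E → ℝ≥0∞} (hf : ∀ i, Measurable (f i)) (I : Finset ℝ≥0) {s : ℝ≥0}
    (hs : ∀ i ∈ I, i ≤ s) {g : E → ℝ≥0∞} (hg : Measurable g) :
    ∫⁻ ω, (∏ i ∈ I, f i (M.X (h + i) ω)) * g (M.X (h + s) ω) ∂(M.initLaw ν) =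
      ∫⁻ ω, (∏ i ∈ I, f i (M.X i ω)) * g (M.X s ω) ∂(M.initLaw (ν.bind (M.transition h))) := by
  induction I using Finset.induction_on_max generalizing s g with
  | empty =>
    have hmarkov (ρ : Measure E) (r : ℝ≥0) : ∫⁻ ω, g (M.X (r + s) ω) ∂(M.initLaw ρ) =
        ∫⁻ x, ∫⁻ y, g y ∂(M.transition s x) ∂(ρ.bind (M.transition r)) := by
      simpa [← map_X_initLaw, lintegral_map hg.lintegral_kernel (M.measurable_X_at r)] using
        M.lintegral_mul_comp_X ρ (s := r) (t := s) (Z := 1) measurable_const hg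
    have hmarkov_zero := hmarkov (ν.bind (M.transition h)) 0
    rw [zero_add, bind_transition_zero] at hmarkov_zero
    simp only [Finset.prod_empty, one_mul, hmarkov, hmarkov_zero]
  | insert t I hI ih =>
    have hts : t ≤ s := hs t (Finset.mem_insert_self t I)
    have hcollapse_zero :=
      M.lintegral_prod_insert_mul_comp_X (ν.bind (M.transition h)) 0 hf hI hts hg
    simp only [zero_add] at hcollapse_zero
    rw [M.lintegral_prod_insert_mul_comp_X ν h hf hI hts hg, hcollapse_zero]
    exact ih (fun i hi => (hI i hi).le) ((hf t).mul hg.lintegral_kernel)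

theorem map_X_add_initLaw (M : MarkovProcess E Ω) (ν : Measure E) [IsFiniteMeasure ν] (h : ℝ≥0)
    {ι : Type*} [Finite ι] (s : ι → ℝ≥0) :
    (M.initLaw ν).map (fun ω i => M.X (h + s i) ω) =
      (M.initLaw (ν.bind (M.transition h))).map (fun ω i => M.X (s i) ω) := by
  classical
  cases nonempty_fintype ι
  set I : Finset ℝ≥0 := Finset.univ.image s
  have hpi (ρ : Measure E) (r : ℝ≥0) {B : ι → Set E} (hB : ∀ i, MeasurableSet (B i)) :
      (M.initLaw ρ).map (fun ω i => M.X (r + s i) ω) (Set.univ.pi B) =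
        ∫⁻ ω, ∏ t ∈ I, (⋂ i, ⋂ _ : s i = t, B i).indicator 1 (M.X (r + t) ω) ∂(M.initLaw ρ) := by
    have hmeas : Measurable fun ω i => M.X (r + s i) ω :=
      measurable_pi_lambda _ fun i => M.measurable_X_at _
    rw [Measure.map_apply hmeas (MeasurableSet.univ_pi hB),
      ← lintegral_indicator_one (hmeas (MeasurableSet.univ_pi hB))]
    refine lintegral_congr fun ω => ?_
    simp only [Set.indicator_apply, Set.mem_preimage, Set.mem_univ_pi, Pi.one_apply,
      Finset.prod_boole, I, Finset.forall_mem_image, Set.mem_iInter, Finset.mem_univ, true_implies]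
    exact if_congr ⟨fun hω a i hi => hi ▸ hω i, fun hω i => hω i rfl⟩ rfl rfl
  have hrect : ∀ A ∈ Set.univ.pi '' Set.univ.pi fun _ : ι => {B : Set E | MeasurableSet B},
      (M.initLaw ν).map (fun ω i => M.X (h + s i) ω) A =
        (M.initLaw (ν.bind (M.transition h))).map (fun ω i => M.X (s i) ω) A := by
    rintro _ ⟨B, hB, rfl⟩
    replace hB i : MeasurableSet (B i) := hB i trivial
    have hpi_zero := hpi (ν.bind (M.transition h)) 0 hB
    simp only [zero_add] at hpi_zero
    rw [hpi ν h hB, hpi_zero]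
    simpa only [Pi.one_apply, mul_one] using M.lintegral_prod_comp_X_add ν h (g := 1)
      (fun t => measurable_one.indicator
        (MeasurableSet.iInter fun i => MeasurableSet.iInter fun _ => hB i)) I
      (fun _ => Finset.le_sup (f := id)) measurable_one
  refine ext_of_generate_finite _ generateFrom_pi.symm isPiSystem_pi hrect ?_
  exact hrect _ ⟨fun _ => Set.univ, fun _ _ => MeasurableSet.univ, Set.pi_univ _⟩

end MarkovProcess

namespace MarkovProcess

variable {E Ω : Type*} [MeasurableSpace E] [MeasurableSpace Ω] {W : E → ℝ} {K : ℝ}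

/-! ## Additive functionals -/

/-- The additive functional `∫_a^b W(X_r) dr` of the process. -/
noncomputable def additiveFunctional (M : MarkovProcess E Ω) (W : E → ℝ) (a b : ℝ) (ω : Ω) : ℝ :=
  ∫ r in a..b, W (M.X r.toNNReal ω)

@[fun_prop]
theorem measurable_X_comp (M : MarkovProcess E Ω) {S : Type*} [MeasurableSpace S] {τ : S → ℝ≥0}
    {ω : S → Ω} (hτ : Measurable τ) (hω : Measurable ω) : Measurable fun p => M.X (τ p) (ω p) :=
  M.measurable_X.comp (hτ.prodMk hω)

@[fun_prop]
theorem measurable_additiveFunctional (M : MarkovProcess E Ω) (hW : Measurable W) {S : Type*}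
    [MeasurableSpace S] {u v : S → ℝ} {ω : S → Ω} (hu : Measurable u) (hv : Measurable v)
    (hω : Measurable ω) : Measurable fun p => M.additiveFunctional W (u p) (v p) (ω p) :=
  measurable_intervalIntegral (F := fun q : ℝ × S => W (M.X q.1.toNNReal (ω q.2)))
    (by fun_prop) hu hv

theorem intervalIntegrable_comp_X (M : MarkovProcess E Ω) (hW : Measurable W)
    (hK : ∀ x, ‖W x‖ ≤ K) (ω : Ω) (a b : ℝ) :
    IntervalIntegrable (fun r : ℝ => W (M.X r.toNNReal ω)) volume a b :=
  intervalIntegrable_of_norm_le (by fun_prop) fun _ _ => hK _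

theorem norm_additiveFunctional_le (M : MarkovProcess E Ω) (hK : ∀ x, ‖W x‖ ≤ K) (a b : ℝ)
    (ω : Ω) : ‖M.additiveFunctional W a b ω‖ ≤ K * |b - a| :=
  intervalIntegral.norm_integral_le_of_norm_le_const fun _ _ => hK _

theorem norm_exp_additiveFunctional_le (M : MarkovProcess E Ω) (hK : ∀ x, ‖W x‖ ≤ K) (a b : ℝ)
    (ω : Ω) : ‖Real.exp (M.additiveFunctional W a b ω)‖ ≤ Real.exp (K * |b - a|) := by
  rw [Real.norm_eq_abs, Real.abs_exp]
  exact Real.exp_le_exp.2 ((Real.le_norm_self _).trans (M.norm_additiveFunctional_le hK a b ω))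

theorem exp_additiveFunctional_eq (M : MarkovProcess E Ω) (hW : Measurable W)
    (hK : ∀ x, ‖W x‖ ≤ K) (t : ℝ) (ω : Ω) :
    Real.exp (M.additiveFunctional W 0 t ω) =
      1 + ∫ s in (0 : ℝ)..t,
        Real.exp (M.additiveFunctional W 0 s ω) * W (M.X s.toNNReal ω) := by
  simpa [additiveFunctional, sub_eq_iff_eq_add'] using
    comp_add_intervalIntegral_sub Real.contDiff_exp (M.intervalIntegrable_comp_X hW hK ω 0 t) 0

theorem additiveFunctional_add (M : MarkovProcess E Ω) (W : E → ℝ) (h t : ℝ≥0) (ω : Ω) :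
    M.additiveFunctional W h (h + t) ω =
      ∫ r in Set.Ioc 0 (t : ℝ), W (M.X (h + r.toNNReal) ω) := by
  have hshift := intervalIntegral.integral_comp_add_left (a := 0) (b := t)
    (fun r : ℝ => W (M.X r.toNNReal ω)) (h : ℝ)
  rw [add_zero] at hshift
  rw [additiveFunctional, ← hshift, intervalIntegral.integral_of_le t.coe_nonneg]
  refine setIntegral_congr_fun measurableSet_Ioc fun r hr => ?_
  simp only [Real.toNNReal_add h.coe_nonneg hr.1.le, Real.toNNReal_coe]

theorem integral_prod_comp_X_add (M : MarkovProcess E Ω) (ν : Measure E) [IsFiniteMeasure ν]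
    (hW : Measurable W) (h : ℝ≥0) {ι : Type*} [Fintype ι] (s : ι → ℝ≥0) :
    ∫ ω, ∏ i, W (M.X (h + s i) ω) ∂(M.initLaw ν) =
      ∫ ω, ∏ i, W (M.X (s i) ω) ∂(M.initLaw (ν.bind (M.transition h))) := by
  have hprod : Measurable fun x : ι → E => ∏ i, W (x i) := by fun_prop
  rw [← integral_map (φ := fun ω i => M.X (h + s i) ω) (f := fun x => ∏ i, W (x i))
      (measurable_pi_lambda _ fun i => M.measurable_X_at _).aemeasurable
      hprod.aestronglyMeasurable, map_X_add_initLaw, integral_map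
      (measurable_pi_lambda _ fun i => M.measurable_X_at _).aemeasurable
      hprod.aestronglyMeasurable]

theorem integral_additiveFunctional_pow_add (M : MarkovProcess E Ω) (ν : Measure E)
    [IsFiniteMeasure ν] (hW : Measurable W) (hK : ∀ x, ‖W x‖ ≤ K) (h t : ℝ≥0) (n : ℕ) :
    ∫ ω, M.additiveFunctional W h (h + t) ω ^ n ∂(M.initLaw ν) =
      ∫ ω, M.additiveFunctional W 0 t ω ^ n ∂(M.initLaw (ν.bind (M.transition h))) := by
  have hzero (ω : Ω) := M.additiveFunctional_add W 0 t ω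
  simp only [NNReal.coe_zero, zero_add] at hzero
  simp only [additiveFunctional_add, hzero]
  rw [integral_pow_integral_swap (F := fun p : ℝ × Ω => W (M.X (h + p.1.toNNReal) p.2))
      (by fun_prop) fun _ => hK _,
    integral_pow_integral_swap (F := fun p : ℝ × Ω => W (M.X p.1.toNNReal p.2))
      (by fun_prop) fun _ => hK _]
  exact integral_congr_ae (Eventually.of_forall fun r =>
    M.integral_prod_comp_X_add ν hW h fun i => (r i).toNNReal)

theorem integral_exp_additiveFunctional_add (M : MarkovProcess E Ω) (ν : Measure E)
    [IsFiniteMeasure ν] (hW : Measurable W) (hK : ∀ x, ‖W x‖ ≤ K) (h t : ℝ≥0) :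
    ∫ ω, Real.exp (M.additiveFunctional W h (h + t) ω) ∂(M.initLaw ν) =
      ∫ ω, Real.exp (M.additiveFunctional W 0 t ω) ∂(M.initLaw (ν.bind (M.transition h))) := by
  rw [integral_exp_eq_tsum (by fun_prop) (M.norm_additiveFunctional_le hK _ _),
    integral_exp_eq_tsum (by fun_prop) (M.norm_additiveFunctional_le hK _ _)]
  simp only [M.integral_additiveFunctional_pow_add ν hW hK]

/-! ## The Feynman–Kac functional -/

/-- The Feynman–Kac functional `E_x[exp(∫_0^t W(X_r) dr) f(X_t)]`. -/
noncomputable def feynmanKac (M : MarkovProcess E Ω) (W : E → ℝ) (t : ℝ) (f : E → ℝ) (x : E) : ℝ :=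
  ∫ ω, Real.exp (M.additiveFunctional W 0 t ω) * f (M.X t.toNNReal ω) ∂(M.law x)

theorem measurable_feynmanKac_prod (M : MarkovProcess E Ω) (hW : Measurable W) {f : E → ℝ}
    (hf : Measurable f) : Measurable fun p : ℝ × E => M.feynmanKac W p.1 f p.2 :=
  measurable_integral_kernel_prod (F := fun p : ℝ × Ω =>
    Real.exp (M.additiveFunctional W 0 p.1 p.2) * f (M.X p.1.toNNReal p.2)) (by fun_prop)

theorem measurable_feynmanKac (M : MarkovProcess E Ω) (hW : Measurable W) {f : E → ℝ}
    (hf : Measurable f) (t : ℝ) : Measurable (M.feynmanKac W t f) :=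
  (M.measurable_feynmanKac_prod hW hf).comp measurable_prodMk_left

theorem norm_exp_additiveFunctional_mul_le (M : MarkovProcess E Ω) (hK : ∀ x, ‖W x‖ ≤ K)
    {f : E → ℝ} {B : ℝ} (hB : ∀ x, ‖f x‖ ≤ B) {s t : ℝ} (hst : |s| ≤ t) (ω : Ω) :
    ‖Real.exp (M.additiveFunctional W 0 s ω) * f (M.X s.toNNReal ω)‖ ≤ Real.exp (K * t) * B := by
  have hK0 : 0 ≤ K := (norm_nonneg _).trans (hK (M.X 0 ω))
  rw [norm_mul]
  refine mul_le_mul ((M.norm_exp_additiveFunctional_le hK 0 s ω).trans ?_) (hB _) (norm_nonneg _)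
    (Real.exp_pos _).le
  rw [sub_zero]
  gcongr

theorem norm_feynmanKac_le (M : MarkovProcess E Ω) (hK : ∀ x, ‖W x‖ ≤ K) {f : E → ℝ} {B : ℝ}
    (hB : ∀ x, ‖f x‖ ≤ B) {s t : ℝ} (hst : |s| ≤ t) (x : E) :
    ‖M.feynmanKac W s f x‖ ≤ Real.exp (K * t) * B := by
  simpa [feynmanKac] using norm_integral_le_of_norm_le_const (μ := M.law x)
    (Eventually.of_forall (M.norm_exp_additiveFunctional_mul_le hK hB hst))

theorem intervalIntegrable_feynmanKac (M : MarkovProcess E Ω) (hW : Measurable W)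
    (hK : ∀ x, ‖W x‖ ≤ K) {f : E → ℝ} (hf : Measurable f) {B : ℝ} (hB : ∀ x, ‖f x‖ ≤ B) (t : ℝ)
    (x : E) : IntervalIntegrable (fun s => M.feynmanKac W s f x) volume 0 t :=
  intervalIntegrable_of_norm_le ((M.measurable_feynmanKac_prod hW hf).comp measurable_prodMk_right)
    fun _ hs => M.norm_feynmanKac_le hK hB
      (by simpa using Set.abs_sub_left_of_mem_uIcc (Set.uIoc_subset_uIcc hs)) x

theorem feynmanKac_one_eq (M : MarkovProcess E Ω) (hW : Measurable W) (hK : ∀ x, ‖W x‖ ≤ K)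
    (t : ℝ) (x : E) :
    M.feynmanKac W t (fun _ => 1) x = 1 + ∫ s in (0 : ℝ)..t, M.feynmanKac W s W x := by
  have hmeas : Measurable fun p : ℝ × Ω =>
      Real.exp (M.additiveFunctional W 0 p.1 p.2) * W (M.X p.1.toNNReal p.2) := by fun_prop
  have hbound : ∀ s ∈ Set.uIoc 0 t, ∀ ω,
      ‖Real.exp (M.additiveFunctional W 0 s ω) * W (M.X s.toNNReal ω)‖ ≤ Real.exp (K * |t|) * K :=
    fun s hs => M.norm_exp_additiveFunctional_mul_le hK hK
      (by simpa using Set.abs_sub_left_of_mem_uIcc (Set.uIoc_subset_uIcc hs))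
  have hint : Integrable (fun ω => ∫ s in (0 : ℝ)..t,
      Real.exp (M.additiveFunctional W 0 s ω) * W (M.X s.toNNReal ω)) (M.law x) :=
    Integrable.of_bound
      (measurable_intervalIntegral hmeas measurable_const measurable_const).aestronglyMeasurable _
      (Eventually.of_forall fun ω => intervalIntegral.norm_integral_le_of_norm_le_const
        fun s hs => hbound s hs ω)
  simp only [feynmanKac, mul_one, M.exp_additiveFunctional_eq hW hK t]
  rw [integral_add (integrable_const _) hint, integral_intervalIntegral_swap hmeas hbound]
  simp

theorem semigroup_feynmanKac_one (M : MarkovProcess E Ω) (hW : Measurable W)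
    (hK : ∀ x, ‖W x‖ ≤ K) (t h : ℝ≥0) (x : E) :
    M.semigroup h (M.feynmanKac W t fun _ => 1) x =
      ∫ ω, Real.exp (M.additiveFunctional W h (h + t) ω) ∂(M.law x) := by
  have hmarkov := M.integral_exp_additiveFunctional_add (Measure.dirac x) hW hK h t
  rw [initLaw_dirac, Measure.dirac_bind (M.transition h).measurable] at hmarkov
  rw [hmarkov, initLaw, integral_bind_kernel]
  · simp only [semigroup, feynmanKac, mul_one]
  · have : IsProbabilityMeasure ((M.transition h x).bind M.law) :=
      M.isProbabilityMeasure_initLaw (M.transition h x)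
    exact Integrable.of_bound (by fun_prop) _
      (Eventually.of_forall (M.norm_exp_additiveFunctional_le hK 0 t))

end MarkovProcess

/-! ## Stochastic continuity of the stationary process -/

theorem norm_sub_le_two_mul {E : Type*} {W : E → ℝ} {K : ℝ} (hK : ∀ x, ‖W x‖ ≤ K) (x y : E) :
    ‖W x - W y‖ ≤ 2 * K :=
  (norm_sub_le _ _).trans (by linarith [hK x, hK y])

namespace MarkovProcess

variable {E Ω : Type*} [MeasurableSpace E] [MeasurableSpace Ω] {W : E → ℝ} {K : ℝ}

theorem integral_norm_sub_comp_X_add (M : MarkovProcess E Ω) {μ : Measure E} [IsFiniteMeasure μ]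
    (hμ : M.IsInvariant μ) (hW : Measurable W) (s h : ℝ≥0) :
    ∫ ω, ‖W (M.X (s + h) ω) - W (M.X s ω)‖ ∂(M.initLaw μ) =
      ∫ ω, ‖W (M.X h ω) - W (M.X 0 ω)‖ ∂(M.initLaw μ) := by
  have hlaw := M.map_X_add_initLaw μ s ![0, h]
  rw [hμ s] at hlaw
  have hmeas (u : Fin 2 → ℝ≥0) : Measurable fun ω i => M.X (u i) ω :=
    measurable_pi_lambda _ fun i => M.measurable_X_at _
  have hincr : Measurable fun x : Fin 2 → E => ‖W (x 1) - W (x 0)‖ := by fun_prop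
  have hintegral := congrArg (fun Q => ∫ x, ‖W (x 1) - W (x 0)‖ ∂Q) hlaw
  rw [integral_map (hmeas fun i => s + ![0, h] i).aemeasurable hincr.aestronglyMeasurable,
    integral_map (hmeas ![0, h]).aemeasurable hincr.aestronglyMeasurable] at hintegral
  simpa using hintegral

/- By stationarity the mean increment at time `0` is the average over `s ∈ [0, 1]` of those at
time `s`, and translations of a fixed path are continuous in `L¹`. -/
theorem tendsto_integral_norm_sub_comp_X_zero (M : MarkovProcess E Ω) {μ : Measure E}
    [IsFiniteMeasure μ] (hμ : M.IsInvariant μ) (hW : Measurable W) (hK : ∀ x, ‖W x‖ ≤ K) :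
    Tendsto (fun h : ℝ≥0 => ∫ ω, ‖W (M.X h ω) - W (M.X 0 ω)‖ ∂(M.initLaw μ)) (𝓝 0) (𝓝 0) := by
  have hmeas (h : ℝ≥0) : Measurable fun p : ℝ × Ω =>
      ‖W (M.X (h + p.1).toNNReal p.2) - W (M.X p.1.toNNReal p.2)‖ := by fun_prop
  have haverage (h : ℝ≥0) : ∫ ω, ‖W (M.X h ω) - W (M.X 0 ω)‖ ∂(M.initLaw μ) =
      ∫ ω, (∫ s in (0 : ℝ)..1, ‖W (M.X (h + s).toNNReal ω) - W (M.X s.toNNReal ω)‖)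
        ∂(M.initLaw μ) := by
    rw [integral_intervalIntegral_swap (B := 2 * K) (hmeas h) fun _ _ _ => by
      simpa using norm_sub_le_two_mul hK _ _]
    have hstationary : ∀ s ∈ Set.uIcc (0 : ℝ) 1,
        ∫ ω, ‖W (M.X (h + s).toNNReal ω) - W (M.X s.toNNReal ω)‖ ∂(M.initLaw μ) =
          ∫ ω, ‖W (M.X h ω) - W (M.X 0 ω)‖ ∂(M.initLaw μ) := fun s hs => by
      rw [Set.uIcc_of_le zero_le_one] at hs
      rw [add_comm, Real.toNNReal_add hs.1 h.coe_nonneg, Real.toNNReal_coe,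
        M.integral_norm_sub_comp_X_add hμ hW]
    rw [intervalIntegral.integral_congr hstationary]
    simp
  simp only [haverage]
  rw [show 𝓝 (0 : ℝ) = 𝓝 (∫ _, 0 ∂(M.initLaw μ)) by rw [integral_zero]]
  refine tendsto_integral_filter_of_dominated_convergence (fun _ => 2 * K)
    (Eventually.of_forall fun h => (measurable_intervalIntegral (hmeas h) measurable_const
      measurable_const).aestronglyMeasurable)
    (Eventually.of_forall fun h => Eventually.of_forall fun ω => ?_) (integrable_const _)
    (Eventually.of_forall fun ω => ?_)
  · simpa using intervalIntegral.norm_integral_le_of_norm_le_const (a := 0) (b := 1) fun s _ =>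
      (norm_norm _).trans_le (norm_sub_le_two_mul hK (M.X (h + s).toNNReal ω) (M.X s.toNNReal ω))
  · have hpath : LocallyIntegrable fun s : ℝ => W (M.X s.toNNReal ω) :=
      (locallyIntegrable_const K).mono (Measurable.aestronglyMeasurable (by fun_prop))
        (Eventually.of_forall fun _ => (hK _).trans (Real.le_norm_self K))
    exact (tendsto_intervalIntegral_norm_translate_sub hpath zero_le_one).comp
      (NNReal.continuous_coe.tendsto' 0 0 rfl)

/-- The integrated oscillation `∫_s^{s+h} |W(X_r) - W(X_s)| dr` of the process after time `s`. -/
noncomputable def oscillation (M : MarkovProcess E Ω) (W : E → ℝ) (s h : ℝ≥0) (ω : Ω) : ℝ :=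
  ∫ r in (s : ℝ)..(s + h), ‖W (M.X r.toNNReal ω) - W (M.X s ω)‖

theorem measurable_oscillation (M : MarkovProcess E Ω) (hW : Measurable W) (s h : ℝ≥0) :
    Measurable (M.oscillation W s h) :=
  measurable_intervalIntegral (F := fun p : ℝ × Ω => ‖W (M.X p.1.toNNReal p.2) - W (M.X s p.2)‖)
    (by fun_prop) measurable_const measurable_const

theorem norm_oscillation_le (M : MarkovProcess E Ω) (hK : ∀ x, ‖W x‖ ≤ K) (s h : ℝ≥0) (ω : Ω) :
    ‖M.oscillation W s h ω‖ ≤ 2 * K * h := by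
  simpa [oscillation] using intervalIntegral.norm_integral_le_of_norm_le_const
    (a := s) (b := s + h) fun r _ =>
      (norm_norm _).trans_le (norm_sub_le_two_mul hK (M.X r.toNNReal ω) (M.X s ω))

theorem integral_oscillation (M : MarkovProcess E Ω) {μ : Measure E} [IsFiniteMeasure μ]
    (hμ : M.IsInvariant μ) (hW : Measurable W) (hK : ∀ x, ‖W x‖ ≤ K) (s h : ℝ≥0) :
    ∫ ω, M.oscillation W s h ω ∂(M.initLaw μ) =
      ∫ r in (0 : ℝ)..h, ∫ ω, ‖W (M.X r.toNNReal ω) - W (M.X 0 ω)‖ ∂(M.initLaw μ) := by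
  have hmeas : Measurable fun p : ℝ × Ω => ‖W (M.X p.1.toNNReal p.2) - W (M.X s p.2)‖ := by
    fun_prop
  simp only [oscillation]
  rw [integral_intervalIntegral_swap (B := 2 * K) hmeas fun _ _ _ => by
    simpa using norm_sub_le_two_mul hK _ _]
  have hshift := intervalIntegral.integral_comp_add_left (a := 0) (b := h) (fun r : ℝ =>
    ∫ ω, ‖W (M.X r.toNNReal ω) - W (M.X s ω)‖ ∂(M.initLaw μ)) (s : ℝ)
  rw [add_zero] at hshift
  refine hshift.symm.trans (intervalIntegral.integral_congr fun r hr => ?_)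
  rw [Set.uIcc_of_le h.coe_nonneg] at hr
  simp only [Real.toNNReal_add s.coe_nonneg hr.1, Real.toNNReal_coe,
    M.integral_norm_sub_comp_X_add hμ hW]

theorem tendsto_coe_nhdsGT_zero : Tendsto ((↑) : ℝ≥0 → ℝ) (𝓝[>] 0) (𝓝[>] 0) :=
  tendsto_nhdsWithin_iff.2 ⟨(NNReal.continuous_coe.tendsto' 0 0 rfl).mono_left nhdsWithin_le_nhds,
    eventually_nhdsWithin_of_forall fun _ h => NNReal.coe_pos.2 h⟩

theorem tendsto_inv_mul_integral_oscillation (M : MarkovProcess E Ω) {μ : Measure E}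
    [IsFiniteMeasure μ] (hμ : M.IsInvariant μ) (hW : Measurable W) (hK : ∀ x, ‖W x‖ ≤ K)
    (s : ℝ≥0) :
    Tendsto (fun h : ℝ≥0 => (h : ℝ)⁻¹ * ∫ ω, M.oscillation W s h ω ∂(M.initLaw μ))
      (𝓝[>] 0) (𝓝 0) := by
  set ρ : ℝ → ℝ := fun r => ∫ ω, ‖W (M.X r.toNNReal ω) - W (M.X 0 ω)‖ ∂(M.initLaw μ) with hρ
  have hρ_zero : ρ 0 = 0 := by simp [hρ]
  have hρ_meas : StronglyMeasurable ρ := by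
    have hmeas : Measurable fun p : ℝ × Ω => ‖W (M.X p.1.toNNReal p.2) - W (M.X 0 p.2)‖ := by
      fun_prop
    exact hmeas.stronglyMeasurable.integral_prod_right'
  have hρ_cont : ContinuousAt ρ 0 := by
    rw [ContinuousAt, hρ_zero]
    exact (M.tendsto_integral_norm_sub_comp_X_zero hμ hW hK).comp
      (continuous_real_toNNReal.tendsto' 0 0 Real.toNNReal_zero)
  have hderiv := intervalIntegral.integral_hasDerivAt_right (a := 0) IntervalIntegrable.refl
    hρ_meas.stronglyMeasurableAtFilter hρ_cont
  rw [hρ_zero, hasDerivAt_iff_tendsto_slope_zero] at hderiv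
  simpa [M.integral_oscillation hμ hW hK, hρ, Function.comp_def] using
    (hderiv.mono_left (nhdsWithin_mono _ fun _ => ne_of_gt)).comp tendsto_coe_nhdsGT_zero

end MarkovProcess

namespace MarkovProcess

variable {E Ω : Type*} [MeasurableSpace E] [MeasurableSpace Ω] {W : E → ℝ} {K : ℝ}

/-! ## The Feynman–Kac functional lies in the domain of the generator -/

/-- The remainder in the first order expansion of `h ↦ exp(∫_h^{h+t} W(X_r) dr)` at `h = 0`. -/
noncomputable def expansionError (M : MarkovProcess E Ω) (W : E → ℝ) (t h : ℝ≥0) (ω : Ω) : ℝ :=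
  (h : ℝ)⁻¹ * (Real.exp (M.additiveFunctional W h (h + t) ω) -
    Real.exp (M.additiveFunctional W 0 t ω)) -
    Real.exp (M.additiveFunctional W 0 t ω) * (W (M.X t ω) - W (M.X 0 ω))

theorem measurable_expansionError (M : MarkovProcess E Ω) (hW : Measurable W) (t h : ℝ≥0) :
    Measurable (M.expansionError W t h) := by
  unfold expansionError
  fun_prop

theorem norm_additiveFunctional_sub_mul_le (M : MarkovProcess E Ω) (hW : Measurable W)
    (hK : ∀ x, ‖W x‖ ≤ K) (s h : ℝ≥0) (ω : Ω) :
    ‖M.additiveFunctional W s (s + h) ω - h * W (M.X s ω)‖ ≤ M.oscillation W s h ω := by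
  have hconst : h * W (M.X s ω) = ∫ _ in (s : ℝ)..(s + h), W (M.X s ω) := by simp
  rw [hconst, additiveFunctional, ← intervalIntegral.integral_sub
    (M.intervalIntegrable_comp_X hW hK ω _ _) intervalIntegrable_const]
  exact intervalIntegral.norm_integral_le_integral_norm (le_add_of_nonneg_right h.coe_nonneg)

theorem additiveFunctional_shift_sub (M : MarkovProcess E Ω) (hW : Measurable W)
    (hK : ∀ x, ‖W x‖ ≤ K) (t h : ℝ) (ω : Ω) :
    M.additiveFunctional W h (h + t) ω - M.additiveFunctional W 0 t ω =
      M.additiveFunctional W t (t + h) ω - M.additiveFunctional W 0 h ω := by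
  have hint := M.intervalIntegrable_comp_X hW hK ω
  simpa [additiveFunctional, add_comm h t] using
    intervalIntegral.integral_interval_sub_interval_comm' (hint h (h + t)) (hint 0 t) (hint h 0)

theorem norm_expansionError_le_oscillation (M : MarkovProcess E Ω) (hW : Measurable W)
    (hK : ∀ x, ‖W x‖ ≤ K) (t : ℝ≥0) {h : ℝ≥0} (hh : 0 < h) (hKh : 2 * K * h ≤ 1) (ω : Ω) :
    ‖M.expansionError W t h ω‖ ≤ Real.exp (K * t) * (4 * K ^ 2 * h +
      (h : ℝ)⁻¹ * (M.oscillation W t h ω + M.oscillation W 0 h ω)) := by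
  have hh' : (0 : ℝ) < h := hh
  set a := M.additiveFunctional W t (t + h) ω - M.additiveFunctional W 0 h ω with ha
  have hexpand : M.expansionError W t h ω = Real.exp (M.additiveFunctional W 0 t ω) *
      ((h : ℝ)⁻¹ * (Real.exp a - 1) - (W (M.X t ω) - W (M.X 0 ω))) := by
    rw [expansionError, ← sub_add_cancel (M.additiveFunctional W h (h + t) ω)
      (M.additiveFunctional W 0 t ω), M.additiveFunctional_shift_sub hW hK, ← ha, Real.exp_add]
    ring
  have ha_le : |a| ≤ 2 * K * h := by
    have hat := M.norm_additiveFunctional_le hK t (t + h) ω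
    have ha0 := M.norm_additiveFunctional_le hK 0 h ω
    rw [add_sub_cancel_left, abs_of_pos hh'] at hat
    rw [sub_zero, abs_of_pos hh'] at ha0
    exact (norm_sub_le _ _).trans ((add_le_add hat ha0).trans_eq (by ring))
  have hquadratic : (h : ℝ)⁻¹ * a ^ 2 ≤ 4 * K ^ 2 * h := by
    rw [inv_mul_le_iff₀ hh', ← sq_abs]
    calc |a| ^ 2 ≤ (2 * K * h) ^ 2 := pow_le_pow_left₀ (abs_nonneg _) ha_le 2
      _ = h * (4 * K ^ 2 * h) := by ring
  have hlinear : |(h : ℝ)⁻¹ * a - (W (M.X t ω) - W (M.X 0 ω))| ≤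
      (h : ℝ)⁻¹ * (M.oscillation W t h ω + M.oscillation W 0 h ω) := by
    have hosc_t := M.norm_additiveFunctional_sub_mul_le hW hK t h ω
    have hosc_zero := M.norm_additiveFunctional_sub_mul_le hW hK 0 h ω
    rw [NNReal.coe_zero, zero_add] at hosc_zero
    rw [show (h : ℝ)⁻¹ * a - (W (M.X t ω) - W (M.X 0 ω)) = (h : ℝ)⁻¹ *
      ((M.additiveFunctional W t (t + h) ω - h * W (M.X t ω)) -
        (M.additiveFunctional W 0 h ω - h * W (M.X 0 ω))) by rw [ha]; field_simp; ring,
      abs_mul, abs_of_pos (inv_pos.2 hh')]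
    gcongr
    exact (norm_sub_le _ _).trans (add_le_add hosc_t hosc_zero)
  rw [hexpand, norm_mul]
  gcongr
  · simpa using M.norm_exp_additiveFunctional_le hK 0 t ω
  · exact (abs_inv_mul_exp_sub_one_sub_le h.coe_nonneg (ha_le.trans hKh)).trans
      (add_le_add hquadratic hlinear)

theorem norm_expansionError_le (M : MarkovProcess E Ω) (hW : Measurable W)
    (hK : ∀ x, ‖W x‖ ≤ K) (t : ℝ≥0) {h : ℝ≥0} (hh : 0 < h) (hKh : 2 * K * h ≤ 1) (ω : Ω) :
    ‖M.expansionError W t h ω‖ ≤ Real.exp (K * t) * (6 * K) := by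
  have hK0 : 0 ≤ K := (norm_nonneg _).trans (hK (M.X 0 ω))
  have hosc (s : ℝ≥0) : (h : ℝ)⁻¹ * M.oscillation W s h ω ≤ 2 * K := by
    rw [inv_mul_le_iff₀ (NNReal.coe_pos.2 hh), mul_comm]
    exact (Real.le_norm_self _).trans (M.norm_oscillation_le hK s h ω)
  refine (M.norm_expansionError_le_oscillation hW hK t hh hKh ω).trans ?_
  gcongr
  linarith [hosc t, hosc 0, mul_le_mul_of_nonneg_left hKh hK0]

theorem eventually_mul_coe_le_one (c : ℝ) : ∀ᶠ h : ℝ≥0 in 𝓝[>] 0, c * h ≤ 1 := by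
  have hlim : Tendsto (fun h : ℝ≥0 => c * (h : ℝ)) (𝓝[>] 0) (𝓝 0) := by
    simpa using (tendsto_coe_nhdsGT_zero.mono_right nhdsWithin_le_nhds).const_mul c
  exact (hlim.eventually_lt_const one_pos).mono fun _ => le_of_lt

theorem tendsto_integral_norm_expansionError (M : MarkovProcess E Ω) {μ : Measure E}
    [IsFiniteMeasure μ] (hμ : M.IsInvariant μ) (hW : Measurable W) (hK : ∀ x, ‖W x‖ ≤ K)
    (t : ℝ≥0) :
    Tendsto (fun h : ℝ≥0 => ∫ ω, ‖M.expansionError W t h ω‖ ∂(M.initLaw μ)) (𝓝[>] 0) (𝓝 0) := by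
  have hosc_int (s h : ℝ≥0) : Integrable (M.oscillation W s h) (M.initLaw μ) :=
    Integrable.of_bound (M.measurable_oscillation hW s h).aestronglyMeasurable _
      (Eventually.of_forall (M.norm_oscillation_le hK s h))
  set bound : ℝ≥0 → ℝ := fun h => Real.exp (K * t) *
    ((M.initLaw μ).real Set.univ * (4 * K ^ 2 * h) +
      ((h : ℝ)⁻¹ * ∫ ω, M.oscillation W t h ω ∂(M.initLaw μ) +
        (h : ℝ)⁻¹ * ∫ ω, M.oscillation W 0 h ω ∂(M.initLaw μ))) with hbound
  have hbound_lim : Tendsto bound (𝓝[>] 0) (𝓝 0) := by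
    have hcoe := tendsto_coe_nhdsGT_zero.mono_right nhdsWithin_le_nhds
    simpa [hbound] using (((hcoe.const_mul (4 * K ^ 2)).const_mul _).add
      ((M.tendsto_inv_mul_integral_oscillation hμ hW hK t).add
        (M.tendsto_inv_mul_integral_oscillation hμ hW hK 0))).const_mul (Real.exp (K * t))
  refine squeeze_zero' (Eventually.of_forall fun h => integral_nonneg fun _ => norm_nonneg _)
    ?_ hbound_lim
  filter_upwards [eventually_mul_coe_le_one (2 * K), self_mem_nhdsWithin] with h hKh hh
  have hsum_int := ((hosc_int t h).fun_add (hosc_int 0 h)).const_mul (h : ℝ)⁻¹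
  calc ∫ ω, ‖M.expansionError W t h ω‖ ∂(M.initLaw μ)
      ≤ ∫ ω, Real.exp (K * t) * (4 * K ^ 2 * h +
          (h : ℝ)⁻¹ * (M.oscillation W t h ω + M.oscillation W 0 h ω)) ∂(M.initLaw μ) :=
        integral_mono_of_nonneg (Eventually.of_forall fun _ => norm_nonneg _)
          (((integrable_const _).fun_add hsum_int).const_mul _)
          (Eventually.of_forall (M.norm_expansionError_le_oscillation hW hK t hh hKh))
    _ = bound h := by
        rw [integral_const_mul, integral_add (integrable_const _) hsum_int,
          integral_const_mul (h : ℝ)⁻¹, integral_add (hosc_int t h) (hosc_int 0 h), integral_const,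
          smul_eq_mul, mul_add (h : ℝ)⁻¹]

theorem ae_comp_X_zero_eq (M : MarkovProcess E Ω) (hW : Measurable W) (x : E) :
    ∀ᵐ ω ∂(M.law x), W (M.X 0 ω) = W x := by
  have hset : MeasurableSet {y | W y = W x} := measurableSet_eq_fun hW measurable_const
  refine (ae_map_iff (M.measurable_X_at 0).aemeasurable hset).1 ?_
  rw [M.map_X_zero, ae_dirac_iff hset]

theorem integral_expansionError (M : MarkovProcess E Ω) (hW : Measurable W)
    (hK : ∀ x, ‖W x‖ ≤ K) (t h : ℝ≥0) (x : E) :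
    ∫ ω, M.expansionError W t h ω ∂(M.law x) =
      (h : ℝ)⁻¹ * (M.semigroup h (M.feynmanKac W t fun _ => 1) x -
        M.feynmanKac W t (fun _ => 1) x) -
        (M.feynmanKac W t W x - W x * M.feynmanKac W t (fun _ => 1) x) := by
  have hexp_int (a b : ℝ) :
      Integrable (fun ω => Real.exp (M.additiveFunctional W a b ω)) (M.law x) :=
    Integrable.of_bound (Measurable.aestronglyMeasurable (by fun_prop)) _
      (Eventually.of_forall (M.norm_exp_additiveFunctional_le hK a b))
  have hmul_int (s : ℝ≥0) : Integrable
      (fun ω => Real.exp (M.additiveFunctional W 0 t ω) * W (M.X s ω)) (M.law x) :=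
    (hexp_int 0 t).mul_bdd (Measurable.aestronglyMeasurable (by fun_prop))
      (Eventually.of_forall fun _ => hK _)
  have hstart : ∫ ω, Real.exp (M.additiveFunctional W 0 t ω) * W (M.X 0 ω) ∂(M.law x) =
      W x * M.feynmanKac W t (fun _ => 1) x := by
    simp only [feynmanKac, mul_one]
    rw [mul_comm, ← integral_mul_const]
    refine integral_congr_ae ?_
    filter_upwards [M.ae_comp_X_zero_eq hW x] with ω hω
    rw [hω]
  have hquotient_int : Integrable (fun ω => Real.exp (M.additiveFunctional W h (h + t) ω) -
      Real.exp (M.additiveFunctional W 0 t ω)) (M.law x) := (hexp_int _ _).sub (hexp_int _ _)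
  have hincr_int : Integrable (fun ω => Real.exp (M.additiveFunctional W 0 t ω) * W (M.X t ω) -
      Real.exp (M.additiveFunctional W 0 t ω) * W (M.X 0 ω)) (M.law x) :=
    (hmul_int t).sub (hmul_int 0)
  simp only [expansionError, mul_sub (Real.exp _)]
  rw [integral_sub (hquotient_int.const_mul _) hincr_int, integral_const_mul,
    integral_sub (hexp_int _ _) (hexp_int _ _), integral_sub (hmul_int t) (hmul_int 0), hstart,
    M.semigroup_feynmanKac_one hW hK]
  simp only [feynmanKac, mul_one, Real.toNNReal_coe]

theorem memLp_feynmanKac (M : MarkovProcess E Ω) {μ : Measure E} [IsFiniteMeasure μ]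
    (hW : Measurable W) (hK : ∀ x, ‖W x‖ ≤ K) {f : E → ℝ} (hf : Measurable f) {B : ℝ}
    (hB : ∀ x, ‖f x‖ ≤ B) (t : ℝ) (p : ℝ≥0∞) : MemLp (M.feynmanKac W t f) p μ :=
  MemLp.of_bound (M.measurable_feynmanKac hW hf t).aestronglyMeasurable _
    (Eventually.of_forall (M.norm_feynmanKac_le hK hB le_rfl))

theorem eLpNorm_integral_law_le (M : MarkovProcess E Ω) {μ : Measure E} [IsFiniteMeasure μ]
    {f : Ω → ℝ} (hf : Measurable f) {B : ℝ} (hB : ∀ ω, ‖f ω‖ ≤ B) :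
    eLpNorm (fun x => ∫ ω, f ω ∂(M.law x)) 2 μ ≤
      ENNReal.ofReal (Real.sqrt (B * ∫ ω, ‖f ω‖ ∂(M.initLaw μ))) := by
  have hnorm_int : Integrable (fun ω => ‖f ω‖) (M.initLaw μ) :=
    Integrable.of_bound hf.norm.aestronglyMeasurable B (Eventually.of_forall (by simpa using hB))
  rcases isEmpty_or_nonempty Ω with hΩ | ⟨⟨ω₀⟩⟩
  · simp [integral_of_isEmpty]
  have hB0 : 0 ≤ B := (norm_nonneg _).trans (hB ω₀)
  refine (eLpNorm_two_le_sqrt_mul_integral_norm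
    hf.stronglyMeasurable.integral_kernel.aestronglyMeasurable fun x => by
      simpa using
        norm_integral_le_of_norm_le_const (μ := M.law x) (Eventually.of_forall hB)).trans ?_
  rw [initLaw, integral_bind_kernel hnorm_int]
  gcongr ENNReal.ofReal (Real.sqrt (B * ?_))
  exact integral_mono_of_nonneg (Eventually.of_forall fun _ => norm_nonneg _)
    (integrable_integral_kernel hnorm_int)
    (Eventually.of_forall fun _ => norm_integral_le_integral_norm _)

theorem hasGenerator_feynmanKac (M : MarkovProcess E Ω) {μ : Measure E} [IsFiniteMeasure μ]
    (hμ : M.IsInvariant μ) (hW : Measurable W) (hK : ∀ x, ‖W x‖ ≤ K) (t : ℝ≥0) :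
    M.HasGenerator μ (M.feynmanKac W t fun _ => 1)
      (fun x => M.feynmanKac W t W x - W x * M.feynmanKac W t (fun _ => 1) x) := by
  have hu_mem := M.memLp_feynmanKac (μ := μ) hW hK measurable_const (fun _ => norm_one.le) t ∞
  have hv_mem := M.memLp_feynmanKac (μ := μ) hW hK hW hK t ∞
  have hW_mem : MemLp W ∞ μ :=
    memLp_top_of_bound hW.aestronglyMeasurable _ (Eventually.of_forall hK)
  refine ⟨hu_mem.mono_exponent le_top, (hv_mem.sub (hu_mem.mul hW_mem)).mono_exponent le_top, ?_⟩
  simp only [← M.integral_expansionError hW hK]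
  have hlim : Tendsto (fun h : ℝ≥0 => ENNReal.ofReal (Real.sqrt (Real.exp (K * t) * (6 * K) *
      ∫ ω, ‖M.expansionError W t h ω‖ ∂(M.initLaw μ)))) (𝓝[>] 0) (𝓝 0) := by
    simpa using ENNReal.tendsto_ofReal (((M.tendsto_integral_norm_expansionError hμ hW hK
      t).const_mul (Real.exp (K * t) * (6 * K))).sqrt)
  refine tendsto_of_tendsto_of_tendsto_of_le_of_le' tendsto_const_nhds hlim
    (Eventually.of_forall fun _ => zero_le) ?_
  filter_upwards [eventually_mul_coe_le_one (2 * K), self_mem_nhdsWithin] with h hKh hh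
  exact M.eLpNorm_integral_law_le (M.measurable_expansionError hW t h)
    (M.norm_expansionError_le hW hK t hh hKh)

end MarkovProcess

namespace MarkovProcess

variable {E Ω : Type*} [MeasurableSpace E] [MeasurableSpace Ω] {W : E → ℝ} {K : ℝ}

/-! ## Growth of the Feynman–Kac functional in `L²` -/

theorem measurable_feynmanKac_one_mul (M : MarkovProcess E Ω) (hW : Measurable W) :
    Measurable fun p : ℝ × E =>
      2 * M.feynmanKac W p.1 (fun _ => 1) p.2 * M.feynmanKac W p.1 W p.2 :=
  ((M.measurable_feynmanKac_prod hW measurable_const).const_mul 2).mul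
    (M.measurable_feynmanKac_prod hW hW)

theorem norm_feynmanKac_one_mul_le (M : MarkovProcess E Ω) (hK : ∀ x, ‖W x‖ ≤ K) {s t : ℝ}
    (hst : |s| ≤ t) (x : E) :
    ‖2 * M.feynmanKac W s (fun _ => 1) x * M.feynmanKac W s W x‖ ≤
      2 * (Real.exp (K * t) * 1) * (Real.exp (K * t) * K) := by
  rw [norm_mul, norm_mul, Real.norm_two]
  gcongr
  · exact M.norm_feynmanKac_le hK (fun _ => norm_one.le) hst x
  · exact M.norm_feynmanKac_le hK hK hst x

theorem feynmanKac_one_sq_eq (M : MarkovProcess E Ω) (hW : Measurable W) (hK : ∀ x, ‖W x‖ ≤ K)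
    (t : ℝ) (x : E) :
    M.feynmanKac W t (fun _ => 1) x ^ 2 =
      1 + ∫ s in (0 : ℝ)..t, 2 * M.feynmanKac W s (fun _ => 1) x * M.feynmanKac W s W x := by
  have hchain := comp_add_intervalIntegral_sub (Φ := fun y => y ^ 2) (contDiff_id.pow 2)
    (M.intervalIntegrable_feynmanKac hW hK hW hK t x) 1
  simp only [← M.feynmanKac_one_eq hW hK, deriv_pow_field, one_pow] at hchain
  simpa using eq_add_of_sub_eq' hchain

theorem integral_feynmanKac_one_sq_eq (M : MarkovProcess E Ω) {μ : Measure E}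
    [IsProbabilityMeasure μ] (hW : Measurable W) (hK : ∀ x, ‖W x‖ ≤ K) (t : ℝ) :
    ∫ x, M.feynmanKac W t (fun _ => 1) x ^ 2 ∂μ = 1 + ∫ s in (0 : ℝ)..t,
      ∫ x, 2 * M.feynmanKac W s (fun _ => 1) x * M.feynmanKac W s W x ∂μ := by
  have hmeas := M.measurable_feynmanKac_one_mul hW
  have hbound : ∀ s ∈ Set.uIoc 0 t, ∀ x,
      ‖2 * M.feynmanKac W s (fun _ => 1) x * M.feynmanKac W s W x‖ ≤
        2 * (Real.exp (K * |t|) * 1) * (Real.exp (K * |t|) * K) := fun s hs =>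
    M.norm_feynmanKac_one_mul_le hK
      (by simpa using Set.abs_sub_left_of_mem_uIcc (Set.uIoc_subset_uIcc hs))
  have hint : Integrable (fun x => ∫ s in (0 : ℝ)..t,
      2 * M.feynmanKac W s (fun _ => 1) x * M.feynmanKac W s W x) μ :=
    Integrable.of_bound (measurable_intervalIntegral hmeas measurable_const
      measurable_const).aestronglyMeasurable _ (Eventually.of_forall fun x =>
        intervalIntegral.norm_integral_le_of_norm_le_const fun s hs => hbound s hs x)
  simp only [M.feynmanKac_one_sq_eq hW hK]
  rw [integral_add (integrable_const _) hint, integral_intervalIntegral_swap hmeas hbound]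
  simp

theorem intervalIntegrable_integral_feynmanKac_one_mul (M : MarkovProcess E Ω) {μ : Measure E}
    [IsFiniteMeasure μ] (hW : Measurable W) (hK : ∀ x, ‖W x‖ ≤ K) (a b : ℝ) :
    IntervalIntegrable
      (fun s => ∫ x, 2 * M.feynmanKac W s (fun _ => 1) x * M.feynmanKac W s W x ∂μ)
      volume a b :=
  intervalIntegrable_of_norm_le
    (M.measurable_feynmanKac_one_mul hW).stronglyMeasurable.integral_prod_right'.measurable
    fun _ hs => norm_integral_le_of_norm_le_const <| Eventually.of_forall <|
      M.norm_feynmanKac_one_mul_le hK <|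
        (abs_le_max_abs_abs hs.1.le hs.2).trans <|
          max_le (abs_min_le_max_abs_abs (a := a) (b := b)) abs_max_le_max_abs_abs

theorem integral_feynmanKac_one_mul_le (M : MarkovProcess E Ω) {μ : Measure E}
    [IsFiniteMeasure μ] (hμ : M.IsInvariant μ) (hW : Measurable W) (hK : ∀ x, ‖W x‖ ≤ K) {Λ : ℝ}
    (hform : ∀ g k : E → ℝ, M.HasGenerator μ g k →
      ∫ x, W x * g x ^ 2 ∂μ + ∫ x, k x * g x ∂μ ≤ Λ * ∫ x, g x ^ 2 ∂μ) {s : ℝ} (hs : 0 ≤ s) :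
    ∫ x, 2 * M.feynmanKac W s (fun _ => 1) x * M.feynmanKac W s W x ∂μ ≤
      2 * Λ * ∫ x, M.feynmanKac W s (fun _ => 1) x ^ 2 ∂μ := by
  set u := M.feynmanKac W s fun _ => 1
  set v := M.feynmanKac W s W
  have hgen := M.hasGenerator_feynmanKac hμ hW hK s.toNNReal
  rw [Real.coe_toNNReal _ hs] at hgen
  have hu_mem : MemLp u 2 μ := hgen.1
  have hv_mem : MemLp v 2 μ := M.memLp_feynmanKac hW hK hW hK s 2
  have hWu_int : Integrable (fun x => W x * u x ^ 2) μ :=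
    hu_mem.integrable_sq.bdd_mul hW.aestronglyMeasurable (Eventually.of_forall hK)
  have hvu_int : Integrable (fun x => v x * u x) μ := hv_mem.integrable_mul hu_mem
  calc ∫ x, 2 * u x * v x ∂μ
      = 2 * (∫ x, W x * u x ^ 2 ∂μ + ∫ x, (v x - W x * u x) * u x ∂μ) := by
        have hsplit (x : E) : (v x - W x * u x) * u x = v x * u x - W x * u x ^ 2 := by ring
        simp only [hsplit]
        rw [integral_sub hvu_int hWu_int, add_sub_cancel, ← integral_const_mul]
        simp only [mul_assoc, mul_comm (u _)]
    _ ≤ 2 * (Λ * ∫ x, u x ^ 2 ∂μ) := by gcongr; exact hform _ _ hgen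
    _ = 2 * Λ * ∫ x, u x ^ 2 ∂μ := by ring

theorem integral_feynmanKac_one_sq_le (M : MarkovProcess E Ω) {μ : Measure E}
    [IsProbabilityMeasure μ] (hμ : M.IsInvariant μ) (hW : Measurable W) (hK : ∀ x, ‖W x‖ ≤ K)
    {Λ : ℝ} (hΛ : 0 ≤ Λ)
    (hform : ∀ g k : E → ℝ, M.HasGenerator μ g k →
      ∫ x, W x * g x ^ 2 ∂μ + ∫ x, k x * g x ∂μ ≤ Λ * ∫ x, g x ^ 2 ∂μ) {T : ℝ} (hT : 0 ≤ T) :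
    ∫ x, M.feynmanKac W T (fun _ => 1) x ^ 2 ∂μ ≤ Real.exp (2 * Λ * T) := by
  set φ : ℝ → ℝ := fun t => ∫ x, M.feynmanKac W t (fun _ => 1) x ^ 2 ∂μ with hφ
  have hφ_eq (t : ℝ) := M.integral_feynmanKac_one_sq_eq (μ := μ) hW hK t
  have hint := M.intervalIntegrable_integral_feynmanKac_one_mul (μ := μ) hW hK
  have hφ_cont : Continuous φ := by
    simp only [hφ, hφ_eq]
    exact continuous_const.add (intervalIntegral.continuous_primitive hint 0)
  have hgronwall := le_mul_exp_of_le_add_mul_integral hφ_cont (A := 1) (mul_nonneg zero_le_two hΛ)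
    hT fun t ht => by
      rw [hφ]
      simp only [hφ_eq t]
      rw [← intervalIntegral.integral_const_mul]
      gcongr
      exact intervalIntegral.integral_mono_on ht.1 (hint 0 t)
        ((hφ_cont.const_mul _).intervalIntegrable _ _) fun s hs =>
          M.integral_feynmanKac_one_mul_le hμ hW hK hform hs.1
  simpa using hgronwall

end MarkovProcess

/-! ## Normalised Young functions and the gauge norm -/

namespace IsContractive

variable {F : ℝ → ℝ}

theorem mul_le_youngOf_add_youngConj (hF : IsContractive F) {x : ℝ} (hx : 0 ≤ x) (y : ℝ) :
    x * y ≤ youngOf F x + youngConj (youngOf F) y :=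
  sub_le_iff_le_add'.1 (le_ciSup (hF.bddAbove_conj y) ⟨x, hx⟩)

theorem youngConj_nonneg (hF : IsContractive F) (y : ℝ) : 0 ≤ youngConj (youngOf F) y := by
  simpa [hF.map_zero] using hF.mul_le_youngOf_add_youngConj le_rfl y

theorem monotone_youngConj (hF : IsContractive F) : Monotone (youngConj (youngOf F)) :=
  fun _ z hyz => ciSup_mono (hF.bddAbove_conj z) fun x =>
    sub_le_sub_right (mul_le_mul_of_nonneg_left hyz x.coe_nonneg) _

variable {α : Type*} [MeasurableSpace α] {μ : Measure α} {f : α → ℝ}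

theorem youngOf_one_le_integral [IsProbabilityMeasure μ] (hF : IsContractive F) (hf : ∀ x, 0 ≤ f x)
    (hfi : Integrable f μ) (hf1 : ∫ x, f x ∂μ = 1)
    (hG : Integrable (fun x => youngOf F (f x)) μ) : youngOf F 1 ≤ ∫ x, youngOf F (f x) ∂μ := by
  have hYoung : ∫ x, f x ∂μ ≤ ∫ x, (youngOf F (f x) + youngConj (youngOf F) 1) ∂μ :=
    integral_mono hfi (hG.add (integrable_const _)) fun x => by
      simpa using hF.mul_le_youngOf_add_youngConj (hf x) 1
  rw [integral_add hG (integrable_const _), hf1, integral_const, probReal_univ, one_smul] at hYoung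
  linarith [hF.normalised]

theorem integrable_youngConj_and_integral_le (hF : IsContractive F) {W : α → ℝ}
    (hW : Measurable W) {u : ℝ}
    (hadm : ∫⁻ x, ENNReal.ofReal (youngConj (youngOf F) (|W x| / u)) ∂μ ≤
      ENNReal.ofReal (youngConj (youngOf F) 1)) :
    Integrable (fun x => youngConj (youngOf F) (|W x| / u)) μ ∧
      ∫ x, youngConj (youngOf F) (|W x| / u) ∂μ ≤ youngConj (youngOf F) 1 := by
  have hmeas : Measurable fun x => youngConj (youngOf F) (|W x| / u) :=
    hF.monotone_youngConj.measurable.comp (by fun_prop)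
  have hnonneg : 0 ≤ᵐ[μ] fun x => youngConj (youngOf F) (|W x| / u) :=
    Eventually.of_forall fun _ => hF.youngConj_nonneg _
  refine ⟨(lintegral_ofReal_ne_top_iff_integrable hmeas.aestronglyMeasurable hnonneg).1
    (ne_top_of_le_ne_top ENNReal.ofReal_ne_top hadm), ?_⟩
  rw [integral_eq_lintegral_of_nonneg_ae hnonneg hmeas.aestronglyMeasurable]
  exact ENNReal.toReal_le_of_le_ofReal (hF.youngConj_nonneg 1) hadm

theorem integral_abs_mul_le_gaugeNorm_mul (hF : IsContractive F) {W : α → ℝ} (hW : Measurable W)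
    (hN : gaugeNorm (youngConj (youngOf F)) μ W ≠ ∞) (hf : ∀ x, 0 ≤ f x)
    (hG : Integrable (fun x => youngOf F (f x)) μ)
    (hpos : 0 < ∫ x, youngOf F (f x) ∂μ + youngConj (youngOf F) 1) :
    ∫ x, |W x| * f x ∂μ ≤ (gaugeNorm (youngConj (youngOf F)) μ W).toReal *
      (∫ x, youngOf F (f x) ∂μ + youngConj (youngOf F) 1) := by
  rw [← div_le_iff₀ hpos, ← ENNReal.ofReal_le_iff_le_toReal hN]
  refine le_iInf fun u => le_iInf fun hu => le_iInf fun hadm => ENNReal.ofReal_le_ofReal ?_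
  obtain ⟨hint, hle⟩ := hF.integrable_youngConj_and_integral_le hW hadm
  rw [div_le_iff₀ hpos]
  calc ∫ x, |W x| * f x ∂μ
      ≤ ∫ x, u * (youngOf F (f x) + youngConj (youngOf F) (|W x| / u)) ∂μ := by
        refine integral_mono_of_nonneg
          (Eventually.of_forall fun x => mul_nonneg (abs_nonneg _) (hf x))
          ((hG.add hint).const_mul u) (Eventually.of_forall fun x => ?_)
        calc |W x| * f x = u * (f x * (|W x| / u)) := by field_simp
          _ ≤ _ := mul_le_mul_of_nonneg_left
            (hF.mul_le_youngOf_add_youngConj (hf x) (|W x| / u)) hu.le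
    _ = u * (∫ x, youngOf F (f x) ∂μ + ∫ x, youngConj (youngOf F) (|W x| / u) ∂μ) := by
        rw [integral_const_mul, integral_add hG hint]
    _ ≤ _ := by gcongr

end IsContractive

section GaugeNorm

variable {α : Type*} [MeasurableSpace α] {μ : Measure α} {Φ : ℝ → ℝ} {f g : α → ℝ}

theorem gaugeNorm_congr_ae (h : f =ᵐ[μ] g) : gaugeNorm Φ μ f = gaugeNorm Φ μ g := by
  have hint (u : ℝ) : ∫⁻ x, ENNReal.ofReal (Φ (|f x| / u)) ∂μ =
      ∫⁻ x, ENNReal.ofReal (Φ (|g x| / u)) ∂μ :=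
    lintegral_congr_ae (h.mono fun x hx => by simp only [hx])
  simp only [gaugeNorm, hint]

theorem gaugeNorm_mono (hΦ : Monotone Φ) (h : ∀ x, |f x| ≤ |g x|) :
    gaugeNorm Φ μ f ≤ gaugeNorm Φ μ g :=
  iInf_mono fun _ => iInf_mono fun hu => iInf_mono' fun hadm =>
    ⟨(lintegral_mono fun x => ENNReal.ofReal_le_ofReal
      (hΦ (div_le_div_of_nonneg_right (h x) hu.le))).trans hadm, le_rfl⟩

end GaugeNorm

namespace MarkovProcess

variable {E Ω : Type*} [MeasurableSpace E] [MeasurableSpace Ω] {M : MarkovProcess E Ω}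
  {μ : Measure E} {g k : E → ℝ}

/-! ## Quadratic forms of potentials on the domain of the generator -/

theorem HasGenerator.const_mul (hgen : M.HasGenerator μ g k) (c : ℝ) :
    M.HasGenerator μ (fun x => c * g x) (fun x => c * k x) := by
  obtain ⟨hg, hk, hlim⟩ := hgen
  refine ⟨hg.const_mul c, hk.const_mul c, ?_⟩
  have hnorm (t : ℝ≥0) :
      eLpNorm (fun x => (t : ℝ)⁻¹ * (M.semigroup t (fun y => c * g y) x - c * g x) - c * k x) 2 μ =
        ‖c‖ₑ * eLpNorm (fun x => (t : ℝ)⁻¹ * (M.semigroup t g x - g x) - k x) 2 μ := by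
    rw [← eLpNorm_const_smul]
    congr 1
    ext x
    simp only [semigroup, integral_const_mul, Pi.smul_apply, smul_eq_mul]
    ring
  simp only [hnorm]
  simpa using ENNReal.Tendsto.const_mul hlim (Or.inr (enorm_ne_top (x := c)))

theorem HasGenerator.sub_const [IsFiniteMeasure μ] (hμ : M.IsInvariant μ)
    (hgen : M.HasGenerator μ g k) (a : ℝ) : M.HasGenerator μ (fun x => g x - a) k := by
  obtain ⟨hg, hk, hlim⟩ := hgen
  refine ⟨hg.sub (memLp_const a), hk, hlim.congr fun t => eLpNorm_congr_ae ?_⟩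
  have hgi : Integrable g (μ.bind (M.transition t)) := by
    rw [(hμ t).def]
    exact hg.integrable one_le_two
  filter_upwards [Measure.ae_integrable_of_integrable_comp hgi] with x hx
  simp [semigroup, integral_sub hx (integrable_const a)]

theorem integrable_semigroup [SFinite μ] (hμ : M.IsInvariant μ) (hg : Integrable g μ) (t : ℝ≥0) :
    Integrable (M.semigroup t g) μ :=
  integrable_integral_kernel (κ := M.transition t) ((hμ t).def.symm ▸ hg)

theorem integral_semigroup [SFinite μ] (hμ : M.IsInvariant μ) (hg : Integrable g μ) (t : ℝ≥0) :
    ∫ x, M.semigroup t g x ∂μ = ∫ x, g x ∂μ := by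
  have hbind := integral_bind_kernel (κ := M.transition t) ((hμ t).def.symm ▸ hg)
  rw [(hμ t).def] at hbind
  exact hbind.symm

theorem HasGenerator.integral_eq_zero [IsProbabilityMeasure μ] (hμ : M.IsInvariant μ)
    (hgen : M.HasGenerator μ g k) : ∫ x, k x ∂μ = 0 := by
  obtain ⟨hg, hk, hlim⟩ := hgen
  have hgi : Integrable g μ := hg.integrable one_le_two
  have hquot (t : ℝ≥0) : Integrable (fun x => (t : ℝ)⁻¹ * (M.semigroup t g x - g x)) μ :=
    ((integrable_semigroup hμ hgi t).sub hgi).const_mul _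
  have hzero (t : ℝ≥0) : ∫ x, (t : ℝ)⁻¹ * (M.semigroup t g x - g x) ∂μ = 0 := by
    rw [integral_const_mul, integral_sub (integrable_semigroup hμ hgi t) hgi,
      integral_semigroup hμ hgi t, sub_self, mul_zero]
  have hlimL1 : Tendsto (fun t : ℝ≥0 => ∫ x, (t : ℝ)⁻¹ * (M.semigroup t g x - g x) ∂μ) (𝓝[>] 0)
      (𝓝 (∫ x, k x ∂μ)) := by
    refine tendsto_integral_of_L1 _ hk.1 (Eventually.of_forall hquot)
      (tendsto_of_tendsto_of_tendsto_of_le_of_le tendsto_const_nhds hlim (fun _ => zero_le)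
        fun t => ?_)
    simp only [← eLpNorm_one_eq_lintegral_enorm]
    exact eLpNorm_le_eLpNorm_of_exponent_le one_le_two ((hquot t).1.sub hk.1)
  simp only [hzero] at hlimL1
  exact tendsto_nhds_unique hlimL1 tendsto_const_nhds

theorem integral_mul_sq_le_of_normalised {w : E → ℝ} {c : ℝ}
    (hnorm : ∀ g k : E → ℝ, M.HasGenerator μ g k → ∫ x, g x ∂μ = 0 → ∫ x, g x ^ 2 ∂μ = 1 →
      ∫ x, w x * g x ^ 2 ∂μ ≤ c * ∫ x, k x * g x ∂μ)
    (hgen : M.HasGenerator μ g k) (hg0 : ∫ x, g x ∂μ = 0) :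
    ∫ x, w x * g x ^ 2 ∂μ ≤ c * ∫ x, k x * g x ∂μ := by
  have hsq_nonneg : 0 ≤ ∫ x, g x ^ 2 ∂μ := integral_nonneg fun _ => sq_nonneg _
  rcases hsq_nonneg.eq_or_lt with hsq | hsq
  · have hg : ∀ᵐ x ∂μ, g x = 0 :=
      ((integral_eq_zero_iff_of_nonneg (fun _ => sq_nonneg _) hgen.1.integrable_sq).1 hsq.symm).mono
        fun x hx => pow_eq_zero_iff two_ne_zero |>.1 hx
    rw [integral_eq_zero_of_ae (hg.mono fun x hx => by simp [hx]),
      integral_eq_zero_of_ae (hg.mono fun x hx => by simp [hx]), mul_zero]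
  · set b : ℝ := (√(∫ x, g x ^ 2 ∂μ))⁻¹ with hb
    have hb2 : b ^ 2 = (∫ x, g x ^ 2 ∂μ)⁻¹ := by rw [hb, inv_pow, Real.sq_sqrt hsq.le]
    have hscaled := hnorm _ _ (hgen.const_mul b) (by rw [integral_const_mul, hg0, mul_zero]) (by
      simp only [mul_pow, integral_const_mul, hb2]
      exact inv_mul_cancel₀ hsq.ne')
    simp only [show ∀ x, w x * (b * g x) ^ 2 = b ^ 2 * (w x * g x ^ 2) by intro; ring,
      show ∀ x, b * k x * (b * g x) = b ^ 2 * (k x * g x) by intro; ring, integral_const_mul,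
      mul_left_comm c] at hscaled
    exact le_of_mul_le_mul_left hscaled (hb2 ▸ inv_pos.2 hsq)

theorem integral_mul_sq_add_integral_mul_le [IsProbabilityMeasure μ] (hμ : M.IsInvariant μ)
    {U : E → ℝ} (hU : Measurable U) {K : ℝ} (hK : ∀ x, ‖U x‖ ≤ K) {c : ℝ} (hc : 0 < c)
    (hpoincare : ∀ g k : E → ℝ, M.HasGenerator μ g k → ∫ x, g x ∂μ = 0 →
      c * ∫ x, g x ^ 2 ∂μ ≤ -(1 / 2) * ∫ x, k x * g x ∂μ)
    (hform : ∀ g k : E → ℝ, M.HasGenerator μ g k → ∫ x, g x ∂μ = 0 →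
      ∫ x, |U x| * g x ^ 2 ∂μ ≤ -(1 / 2) * ∫ x, k x * g x ∂μ)
    (hgen : M.HasGenerator μ g k) :
    ∫ x, U x * g x ^ 2 ∂μ + ∫ x, k x * g x ∂μ ≤
      (c⁻¹ * ∫ x, U x ^ 2 ∂μ + |∫ x, U x ∂μ|) * ∫ x, g x ^ 2 ∂μ := by
  set a : ℝ := ∫ x, g x ∂μ with ha
  have hgi : Integrable g μ := hgen.1.integrable one_le_two
  have hki : Integrable k μ := hgen.2.1.integrable one_le_two
  have hcentred : ∫ x, (g x - a) ∂μ = 0 := by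
    rw [integral_sub hgi (integrable_const a), integral_const, probReal_univ, one_smul, sub_self]
  have hkg : ∫ x, k x * (g x - a) ∂μ = ∫ x, k x * g x ∂μ := by
    simp only [mul_sub]
    have hkg : Integrable (fun x => k x * g x) μ := hgen.2.1.integrable_mul hgen.1
    rw [integral_sub hkg (hki.mul_const a), integral_mul_const,
      hgen.integral_eq_zero hμ, zero_mul, sub_zero]
  have hsq_le : a ^ 2 ≤ ∫ x, g x ^ 2 ∂μ := by
    simpa [variance_eq_sub hgen.1, ← ha] using variance_nonneg g μ
  have hP := hpoincare _ _ (hgen.sub_const hμ a) hcentred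
  have hW := hform _ _ (hgen.sub_const hμ a) hcentred
  rw [hkg] at hP hW
  calc ∫ x, U x * g x ^ 2 ∂μ + ∫ x, k x * g x ∂μ
      ≤ a ^ 2 * ∫ x, U x ∂μ + a ^ 2 * (c⁻¹ * ∫ x, U x ^ 2 ∂μ) := by
        linarith [integral_mul_sq_le_add hU hK hc hgen.1 a]
    _ ≤ (c⁻¹ * ∫ x, U x ^ 2 ∂μ + |∫ x, U x ∂μ|) * a ^ 2 := by
        linarith [mul_le_mul_of_nonneg_left (le_abs_self (∫ x, U x ∂μ)) (sq_nonneg a)]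
    _ ≤ _ := by gcongr

end MarkovProcess

/-! ## Consequences of the strong `F`-Sobolev inequality -/

namespace StrongFSobolev

variable {E Ω : Type*} [MeasurableSpace E] [MeasurableSpace Ω] {M : MarkovProcess E Ω}
  {μ : Measure E} [IsProbabilityMeasure μ] {F : ℝ → ℝ} {C : ℝ}

theorem poincare (hSob : StrongFSobolev M μ F C) (hF : IsContractive F) {g k : E → ℝ}
    (hgen : M.HasGenerator μ g k) (hg0 : ∫ x, g x ∂μ = 0) :
    youngOf F 1 * ∫ x, g x ^ 2 ∂μ ≤ -C * ∫ x, k x * g x ∂μ := by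
  rw [← integral_const_mul]
  refine MarkovProcess.integral_mul_sq_le_of_normalised (fun g k hgen hg0 hg1 => ?_) hgen hg0
  obtain ⟨hG, hle⟩ := hSob g k hgen hg0 hg1
  rw [integral_const_mul, hg1, mul_one]
  exact (hF.youngOf_one_le_integral (fun x => sq_nonneg (g x)) hgen.1.integrable_sq hg1
    hG).trans hle

theorem integral_abs_mul_sq_le (hSob : StrongFSobolev M μ F C) (hF : IsContractive F)
    (hG₁ : 0 < youngOf F 1) {W : E → ℝ} (hW : Measurable W)
    (hN : gaugeNorm (youngConj (youngOf F)) μ W ≠ ∞) {g k : E → ℝ}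
    (hgen : M.HasGenerator μ g k) (hg0 : ∫ x, g x ∂μ = 0) :
    ∫ x, |W x| * g x ^ 2 ∂μ ≤
      -((gaugeNorm (youngConj (youngOf F)) μ W).toReal * C / youngOf F 1) *
        ∫ x, k x * g x ∂μ := by
  refine MarkovProcess.integral_mul_sq_le_of_normalised (fun g k hgen hg0 hg1 => ?_) hgen hg0
  obtain ⟨hG, hle⟩ := hSob g k hgen hg0 hg1
  change Integrable (fun x => youngOf F (g x ^ 2)) μ at hG
  change ∫ x, youngOf F (g x ^ 2) ∂μ ≤ _ at hle
  set S : ℝ := ∫ x, youngOf F (g x ^ 2) ∂μ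
  set N : ℝ := (gaugeNorm (youngConj (youngOf F)) μ W).toReal
  have hS : youngOf F 1 ≤ S :=
    hF.youngOf_one_le_integral (fun x => sq_nonneg (g x)) hgen.1.integrable_sq hg1 hG
  have hconj := hF.youngConj_nonneg 1
  calc ∫ x, |W x| * g x ^ 2 ∂μ ≤ N * (S + youngConj (youngOf F) 1) :=
        hF.integral_abs_mul_le_gaugeNorm_mul hW hN (fun x => sq_nonneg (g x)) hG (by linarith)
    _ ≤ N * (S / youngOf F 1) := by
        gcongr
        rw [le_div_iff₀ hG₁]
        nlinarith [hF.normalised]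
    _ ≤ N * ((-C * ∫ x, k x * g x ∂μ) / youngOf F 1) := by gcongr
    _ = _ := by ring

end StrongFSobolev

namespace MarkovProcess

variable {E Ω : Type*} [MeasurableSpace E] [MeasurableSpace Ω] {M : MarkovProcess E Ω}
  {μ ν : Measure E} {V W : E → ℝ}

/-! ## Occupation integrals under an invariant law -/

theorem initLaw_absolutelyContinuous (M : MarkovProcess E Ω) (hν : ν ≪ μ) :
    M.initLaw ν ≪ M.initLaw μ :=
  hν.comp_right M.law

theorem lintegral_setLIntegral_comp_X [IsFiniteMeasure μ] (hμ : M.IsInvariant μ) {f : E → ℝ≥0∞}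
    (hf : Measurable f) (t : ℝ) :
    ∫⁻ ω, (∫⁻ s in Set.Ioc 0 t, f (M.X s.toNNReal ω)) ∂(M.initLaw μ) =
      ENNReal.ofReal t * ∫⁻ x, f x ∂μ := by
  have hmeas : Measurable fun p : Ω × ℝ => f (M.X p.2.toNNReal p.1) := by fun_prop
  have hmarginal (s : ℝ) : ∫⁻ ω, f (M.X s.toNNReal ω) ∂(M.initLaw μ) = ∫⁻ x, f x ∂μ := by
    rw [← lintegral_map hf (M.measurable_X_at _), M.map_X_initLaw, (hμ _).def]
  rw [lintegral_lintegral_swap hmeas.aemeasurable]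
  simp [hmarginal, mul_comm]

theorem ae_forall_ae_comp_X [IsFiniteMeasure μ] (hμ : M.IsInvariant μ) {p : E → Prop}
    (hp : ∀ᵐ x ∂μ, p x) (t : ℝ) :
    ∀ᵐ ω ∂(M.initLaw μ), ∀ᵐ s ∂(volume.restrict (Set.Ioc 0 t)), p (M.X s.toNNReal ω) := by
  obtain ⟨N, hN, hN_meas, hN_null⟩ := exists_measurable_superset_of_null (ae_iff.1 hp)
  have hind : Measurable (N.indicator (1 : E → ℝ≥0∞)) := measurable_one.indicator hN_meas
  have hzero := lintegral_setLIntegral_comp_X hμ hind t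
  rw [lintegral_indicator_one hN_meas, hN_null, mul_zero] at hzero
  have hmeas : Measurable fun q : Ω × ℝ => N.indicator (1 : E → ℝ≥0∞) (M.X q.2.toNNReal q.1) := by
    fun_prop
  filter_upwards [(lintegral_eq_zero_iff hmeas.lintegral_prod_right').1 hzero] with ω hω
  filter_upwards [(lintegral_eq_zero_iff (hmeas.comp measurable_prodMk_left)).1 hω] with s hs
  by_contra hps
  simp [hN hps] at hs

theorem ae_intervalIntegrable_comp_X [IsFiniteMeasure μ] (hμ : M.IsInvariant μ)
    (hV : Integrable V μ) {t : ℝ} (ht : 0 ≤ t) :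
    ∀ᵐ ω ∂(M.initLaw μ), IntervalIntegrable (fun s : ℝ => V (M.X s.toNNReal ω)) volume 0 t := by
  obtain ⟨V', hV'_meas, hVV'⟩ := hV.1.aemeasurable
  have hmeas : Measurable fun p : Ω × ℝ => ‖V' (M.X p.2.toNNReal p.1)‖ₑ := by fun_prop
  have hfin : ∫⁻ ω, (∫⁻ s in Set.Ioc 0 t, ‖V' (M.X s.toNNReal ω)‖ₑ) ∂(M.initLaw μ) ≠ ∞ := by
    rw [lintegral_setLIntegral_comp_X hμ (f := fun x => ‖V' x‖ₑ) hV'_meas.enorm]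
    exact ENNReal.mul_ne_top ENNReal.ofReal_ne_top (hV.congr hVV').2.ne
  filter_upwards [ae_lt_top hmeas.lintegral_prod_right' hfin, ae_forall_ae_comp_X hμ hVV' t]
    with ω hω hVV'ω
  rw [intervalIntegrable_iff_integrableOn_Ioc_of_le ht]
  have hV'ω : IntegrableOn (fun s : ℝ => V' (M.X s.toNNReal ω)) (Set.Ioc 0 t) :=
    ⟨Measurable.aestronglyMeasurable (by fun_prop), hω⟩
  exact hV'ω.congr (hVV'ω.mono fun _ h => h.symm)

theorem ae_additiveFunctional_eq [IsFiniteMeasure μ] (hμ : M.IsInvariant μ) (h : V =ᵐ[μ] W) {t : ℝ}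
    (ht : 0 ≤ t) :
    ∀ᵐ ω ∂(M.initLaw μ), M.additiveFunctional V 0 t ω = M.additiveFunctional W 0 t ω := by
  filter_upwards [ae_forall_ae_comp_X hμ h t] with ω hω
  simp only [additiveFunctional, intervalIntegral.integral_of_le ht]
  exact integral_congr_ae hω

/-! ## Exponential moments of additive functionals -/

theorem lintegral_exp_additiveFunctional_eq (M : MarkovProcess E Ω) (hW : Measurable W) {K : ℝ}
    (hK : ∀ x, ‖W x‖ ≤ K) (ν : Measure E) (t : ℝ) :
    ∫⁻ ω, ENNReal.ofReal (Real.exp (M.additiveFunctional W 0 t ω)) ∂(M.initLaw ν) =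
      ∫⁻ x, ENNReal.ofReal (M.feynmanKac W t (fun _ => 1) x) ∂ν := by
  have hmeas : Measurable fun ω => Real.exp (M.additiveFunctional W 0 t ω) := by fun_prop
  rw [initLaw, Measure.lintegral_bind M.law.measurable.aemeasurable (by fun_prop)]
  refine lintegral_congr fun x => ?_
  simp only [feynmanKac, mul_one]
  exact (ofReal_integral_eq_lintegral_ofReal
    (Integrable.of_bound hmeas.aestronglyMeasurable _
      (Eventually.of_forall (M.norm_exp_additiveFunctional_le hK 0 t)))
    (Eventually.of_forall fun _ => (Real.exp_pos _).le)).symm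

theorem lintegral_exp_additiveFunctional_le [IsProbabilityMeasure μ] (hμ : M.IsInvariant μ)
    (hW : Measurable W) {K : ℝ} (hK : ∀ x, ‖W x‖ ≤ K) {Λ : ℝ} (hΛ : 0 ≤ Λ)
    (hform : ∀ g k : E → ℝ, M.HasGenerator μ g k →
      ∫ x, W x * g x ^ 2 ∂μ + ∫ x, k x * g x ∂μ ≤ Λ * ∫ x, g x ^ 2 ∂μ)
    [SigmaFinite ν] (hν : ν ≪ μ) {t : ℝ} (ht : 0 ≤ t) :
    ∫⁻ ω, ENNReal.ofReal (Real.exp (M.additiveFunctional W 0 t ω)) ∂(M.initLaw ν) ≤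
      eLpNorm (ν.rnDeriv μ) 2 μ * ENNReal.ofReal (Real.exp (Λ * t)) := by
  set u := M.feynmanKac W t fun _ => 1
  have hu_meas : Measurable u := M.measurable_feynmanKac hW measurable_const t
  have hu_nonneg (x : E) : 0 ≤ u x := integral_nonneg fun ω => by positivity
  have hu_mem : MemLp u 2 μ := M.memLp_feynmanKac hW hK measurable_const (fun _ => norm_one.le) t 2
  have hsq : ∫⁻ x, ENNReal.ofReal (u x) ^ (2 : ℝ) ∂μ = ENNReal.ofReal (∫ x, u x ^ 2 ∂μ) := by
    rw [ofReal_integral_eq_lintegral_ofReal hu_mem.integrable_sq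
      (Eventually.of_forall fun _ => sq_nonneg _)]
    simp only [ENNReal.rpow_ofNat, ENNReal.ofReal_pow (hu_nonneg _)]
  rw [M.lintegral_exp_additiveFunctional_eq hW hK]
  refine (lintegral_le_eLpNorm_rnDeriv_mul hν hu_meas.ennreal_ofReal).trans ?_
  rw [hsq, ENNReal.ofReal_rpow_of_nonneg (integral_nonneg fun _ => sq_nonneg _) (by norm_num),
    ← Real.sqrt_eq_rpow]
  gcongr
  rw [Real.sqrt_le_left (Real.exp_pos _).le, ← Real.exp_nat_mul]
  convert M.integral_feynmanKac_one_sq_le hμ hW hK hΛ hform ht using 2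
  push_cast
  ring

theorem lintegral_exp_additiveFunctional_le_liminf {U : ℕ → E → ℝ} (hU : ∀ n, Measurable (U n))
    (hUV : ∀ n x, |U n x| ≤ |V x|) (hlim : ∀ x, Tendsto (fun n => U n x) atTop (𝓝 (V x)))
    [IsFiniteMeasure μ] (hμ : M.IsInvariant μ) (hV : Integrable V μ) (hν : ν ≪ μ)
    {t : ℝ} (ht : 0 ≤ t) :
    ∫⁻ ω, ENNReal.ofReal (Real.exp (M.additiveFunctional V 0 t ω)) ∂(M.initLaw ν) ≤
      liminf (fun n => ∫⁻ ω, ENNReal.ofReal (Real.exp (M.additiveFunctional (U n) 0 t ω))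
        ∂(M.initLaw ν)) atTop := by
  refine (lintegral_mono_ae ?_).trans (lintegral_liminf_le fun n =>
    (M.measurable_additiveFunctional (hU n) measurable_const measurable_const
      measurable_id).exp.ennreal_ofReal)
  filter_upwards [(M.initLaw_absolutelyContinuous hν).ae_le
    (ae_intervalIntegrable_comp_X hμ hV ht)] with ω hω
  refine (Tendsto.liminf_eq (ENNReal.tendsto_ofReal
    ((Real.continuous_exp.tendsto _).comp ?_))).ge
  exact intervalIntegral.tendsto_integral_filter_of_dominated_convergence
    (fun s => |V (M.X s.toNNReal ω)|)
    (Eventually.of_forall fun n =>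
      have := hU n
      Measurable.aestronglyMeasurable (by fun_prop))
    (Eventually.of_forall fun n => Eventually.of_forall fun s _ => hUV n _) hω.abs
    (Eventually.of_forall fun s _ => hlim _)

end MarkovProcess

/-! ## The threshold and the rate -/

theorem lambdaTwo_anti {α : Type*} [MeasurableSpace α] {μ : Measure α} {F : ℝ → ℝ}
    (hF : IsContractive F) (C : ℝ) {V W : α → ℝ} (h : ∀ x, |W x| ≤ |V x|) :
    lambdaTwo F C μ V ≤ lambdaTwo F C μ W := by
  unfold lambdaTwo
  gcongr
  exact gaugeNorm_mono hF.monotone_youngConj h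

theorem mul_gaugeNorm_le_of_ofReal_le_lambdaTwo {α : Type*} [MeasurableSpace α] {μ : Measure α}
    {F : ℝ → ℝ} {C : ℝ} (hC : 0 < C) {V : α → ℝ} {l : ℝ} (hl : 0 < l)
    (h : ENNReal.ofReal l ≤ lambdaTwo F C μ V) :
    0 < youngOf F 1 ∧ gaugeNorm (youngConj (youngOf F)) μ V ≠ ∞ ∧
      l * (2 * C * (gaugeNorm (youngConj (youngOf F)) μ V).toReal) ≤ youngOf F 1 := by
  have hpos : lambdaTwo F C μ V ≠ 0 := ((ENNReal.ofReal_pos.2 hl).trans_le h).ne'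
  have hG₁ : 0 < youngOf F 1 := by
    by_contra hG₁
    simp [lambdaTwo, ENNReal.ofReal_of_nonpos (not_lt.1 hG₁)] at hpos
  have hN : gaugeNorm (youngConj (youngOf F)) μ V ≠ ∞ := by
    intro hN
    simp [lambdaTwo, hN, ENNReal.mul_top, hC] at hpos
  refine ⟨hG₁, hN, ?_⟩
  rw [lambdaTwo, ENNReal.le_div_iff_mul_le (Or.inr (by simpa using hG₁))
    (Or.inr ENNReal.ofReal_ne_top)] at h
  simpa [ENNReal.toReal_mul, hl.le, hC.le, hG₁.le] using
    ENNReal.toReal_mono ENNReal.ofReal_ne_top h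

theorem le_mul_exp_neg_mul_iff {p K : ℝ≥0∞} (hK₀ : K ≠ 0) (hK : K ≠ ∞) {t : ℝ} (ht : 0 < t)
    (x : EReal) :
    p ≤ K * EReal.exp (-(t * x)) ↔ x ≤ -ENNReal.log (p / K) / t := by
  have ht' : (0 : EReal) < t := by exact_mod_cast ht
  rw [mul_comm K, ← ENNReal.div_le_iff_le_mul (Or.inl hK₀) (Or.inl hK), ← ENNReal.exp_log (p / K),
    EReal.exp_le_exp_iff, EReal.le_neg, EReal.le_div_iff_mul_le ht' (EReal.coe_ne_top t),
    mul_comm x, ENNReal.exp_log]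

theorem le_mul_exp_deviationRate {p K : ℝ≥0∞} (hK : K ≠ ∞) {t : ℝ} (ht : 0 < t)
    {G₁ C m R : ℝ} {l₂ : ℝ≥0∞}
    (h : ∀ l : ℝ, 0 ≤ l → ENNReal.ofReal l ≤ l₂ →
      p ≤ K * ENNReal.ofReal (Real.exp (-(t * (R * l - (2 * m ^ 2 * C / G₁) * l ^ 2))))) :
    p ≤ K * EReal.exp (-((t : EReal) * deviationRate G₁ C m R l₂)) := by
  rcases eq_or_ne K 0 with rfl | hK₀
  · simpa using h 0 le_rfl (by simp)
  rw [le_mul_exp_neg_mul_iff hK₀ hK ht]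
  refine iSup₂_le fun l hl => ?_
  rw [← le_mul_exp_neg_mul_iff hK₀ hK ht]
  exact_mod_cast h l hl.1 hl.2

/-! ## The deviation inequality -/

theorem measurable_truncation {α : Type*} [MeasurableSpace α] {f : α → ℝ} (hf : Measurable f)
    (a : ℝ) : Measurable (truncation f a) :=
  (measurable_id.indicator measurableSet_Ioc).comp hf

theorem tendsto_truncation_natCast {α : Type*} (f : α → ℝ) (x : α) :
    Tendsto (fun n : ℕ => truncation f n x) atTop (𝓝 (f x)) :=
  tendsto_const_nhds.congr' <| (tendsto_natCast_atTop_atTop.eventually_gt_atTop |f x|).mono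
    fun _ hn => (truncation_eq_self hn).symm

namespace MarkovProcess

variable {E Ω : Type*} [MeasurableSpace E] [MeasurableSpace Ω] {M : MarkovProcess E Ω}
  {μ ν : Measure E}

theorem initLaw_le_eLpNorm_rnDeriv_mul (hν : ν ≪ μ) {A : Set Ω} {e : ℝ≥0∞}
    (hμA : M.initLaw μ A ≤ e)
    (hνA : eLpNorm (ν.rnDeriv μ) 2 μ ≠ ∞ → M.initLaw ν A ≤ eLpNorm (ν.rnDeriv μ) 2 μ * e) :
    M.initLaw ν A ≤ eLpNorm (ν.rnDeriv μ) 2 μ * e := by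
  by_cases hnorm : eLpNorm (ν.rnDeriv μ) 2 μ = ∞
  · rcases eq_or_ne e 0 with rfl | he
    · simp [M.initLaw_absolutelyContinuous hν (le_zero_iff.1 hμA)]
    · simp [hnorm, ENNReal.top_mul he]
  · exact hνA hnorm

end MarkovProcess

namespace StrongFSobolev

variable {E Ω : Type*} [MeasurableSpace E] [MeasurableSpace Ω] {M : MarkovProcess E Ω}
  {μ : Measure E} [IsProbabilityMeasure μ] {F : ℝ → ℝ} {C : ℝ} {V W : E → ℝ} {l : ℝ}
  {ν : Measure E}

theorem integral_mul_sq_add_integral_mul_le (hSob : StrongFSobolev M μ F C)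
    (hμ : M.IsInvariant μ) (hF : IsContractive F) (hC : 0 < C) (hW : Measurable W) {K : ℝ}
    (hK : ∀ x, ‖W x‖ ≤ K) (hl : 0 < l) (hle : ENNReal.ofReal l ≤ lambdaTwo F C μ W)
    {g k : E → ℝ} (hgen : M.HasGenerator μ g k) :
    ∫ x, l * W x * g x ^ 2 ∂μ + ∫ x, k x * g x ∂μ ≤
      (2 * C / youngOf F 1 * l ^ 2 * ∫ x, W x ^ 2 ∂μ + l * |∫ x, W x ∂μ|) *
        ∫ x, g x ^ 2 ∂μ := by
  obtain ⟨hG₁, hN, hlN⟩ := mul_gaugeNorm_le_of_ofReal_le_lambdaTwo hC hl hle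
  have hpoincare (g k : E → ℝ) (hgen : M.HasGenerator μ g k) (hg0 : ∫ x, g x ∂μ = 0) :
      youngOf F 1 / (2 * C) * ∫ x, g x ^ 2 ∂μ ≤ -(1 / 2) * ∫ x, k x * g x ∂μ := by
    rw [div_mul_eq_mul_div, div_le_iff₀ (by positivity)]
    linarith [hSob.poincare hF hgen hg0]
  have hform (g k : E → ℝ) (hgen : M.HasGenerator μ g k) (hg0 : ∫ x, g x ∂μ = 0) :
      ∫ x, |l * W x| * g x ^ 2 ∂μ ≤ -(1 / 2) * ∫ x, k x * g x ∂μ := by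
    have henergy : 0 ≤ -∫ x, k x * g x ∂μ := by
      have := mul_nonneg hG₁.le (integral_nonneg (μ := μ) fun x => sq_nonneg (g x))
      nlinarith [hSob.poincare hF hgen hg0]
    calc ∫ x, |l * W x| * g x ^ 2 ∂μ
        = l * ∫ x, |W x| * g x ^ 2 ∂μ := by
          simp only [abs_mul, abs_of_pos hl, mul_assoc, integral_const_mul]
      _ ≤ l * (-((gaugeNorm (youngConj (youngOf F)) μ W).toReal * C / youngOf F 1) *
            ∫ x, k x * g x ∂μ) := by
          gcongr
          exact hSob.integral_abs_mul_sq_le hF hG₁ hW hN hgen hg0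
      _ = l * (2 * C * (gaugeNorm (youngConj (youngOf F)) μ W).toReal) / youngOf F 1 *
            (1 / 2 * -∫ x, k x * g x ∂μ) := by ring
      _ ≤ 1 * (1 / 2 * -∫ x, k x * g x ∂μ) := by
          gcongr
          exact (div_le_one hG₁).2 hlN
      _ = -(1 / 2) * ∫ x, k x * g x ∂μ := by ring
  have hbound := MarkovProcess.integral_mul_sq_add_integral_mul_le hμ (hW.const_mul l)
    (fun x => norm_mul_le_of_le le_rfl (hK x)) (by positivity) hpoincare hform hgen
  simpa only [mul_pow, integral_const_mul, inv_div, mul_assoc, abs_mul, abs_of_pos hl] using hbound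

theorem lintegral_exp_additiveFunctional_le_of_bounded (hSob : StrongFSobolev M μ F C)
    (hμ : M.IsInvariant μ) (hF : IsContractive F) (hC : 0 < C) (hW : Measurable W) {K : ℝ}
    (hK : ∀ x, ‖W x‖ ≤ K) (hl : 0 < l) (hle : ENNReal.ofReal l ≤ lambdaTwo F C μ W)
    [SigmaFinite ν] (hν : ν ≪ μ) {t : ℝ} (ht : 0 ≤ t) :
    ∫⁻ ω, ENNReal.ofReal (Real.exp (M.additiveFunctional (fun x => l * W x) 0 t ω))
        ∂(M.initLaw ν) ≤
      eLpNorm (ν.rnDeriv μ) 2 μ * ENNReal.ofReal (Real.exp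
        ((2 * C / youngOf F 1 * l ^ 2 * ∫ x, W x ^ 2 ∂μ + l * |∫ x, W x ∂μ|) * t)) := by
  have hG₁ := (mul_gaugeNorm_le_of_ofReal_le_lambdaTwo hC hl hle).1
  exact MarkovProcess.lintegral_exp_additiveFunctional_le hμ (hW.const_mul l)
    (fun x => norm_mul_le_of_le le_rfl (hK x)) (by positivity)
    (fun g k hgen => hSob.integral_mul_sq_add_integral_mul_le hμ hF hC hW hK hl hle hgen) hν ht

theorem lintegral_exp_additiveFunctional_le (hSob : StrongFSobolev M μ F C)
    (hμ : M.IsInvariant μ) (hF : IsContractive F) (hC : 0 < C) (hVm : Measurable V)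
    (hV : MemLp V 2 μ) (hV0 : ∫ x, V x ∂μ = 0) (hl : 0 < l)
    (hle : ENNReal.ofReal l ≤ lambdaTwo F C μ V) [SigmaFinite ν] (hν : ν ≪ μ)
    (hν₂ : eLpNorm (ν.rnDeriv μ) 2 μ ≠ ∞) {t : ℝ} (ht : 0 ≤ t) :
    ∫⁻ ω, ENNReal.ofReal (Real.exp (M.additiveFunctional (fun x => l * V x) 0 t ω))
        ∂(M.initLaw ν) ≤
      eLpNorm (ν.rnDeriv μ) 2 μ * ENNReal.ofReal (Real.exp
        (2 * C / youngOf F 1 * l ^ 2 * (∫ x, V x ^ 2 ∂μ) * t)) := by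
  have hG₁ := (mul_gaugeNorm_le_of_ofReal_le_lambdaTwo hC hl hle).1
  let U : ℕ → E → ℝ := fun n => truncation V n
  have hU (n : ℕ) : Measurable (U n) := measurable_truncation hVm n
  have hUV (n : ℕ) (x : E) : |U n x| ≤ |V x| := abs_truncation_le_abs_self V n x
  let B : ℝ → ℝ≥0∞ := fun a => eLpNorm (ν.rnDeriv μ) 2 μ * ENNReal.ofReal (Real.exp
    ((2 * C / youngOf F 1 * l ^ 2 * ∫ x, V x ^ 2 ∂μ + l * |a|) * t))
  have hbound (n : ℕ) : ∫⁻ ω, ENNReal.ofReal (Real.exp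
      (M.additiveFunctional (fun x => l * U n x) 0 t ω)) ∂(M.initLaw ν) ≤ B (∫ x, U n x ∂μ) := by
    refine (hSob.lintegral_exp_additiveFunctional_le_of_bounded hμ hF hC (hU n)
      (abs_truncation_le_bound V n) hl (hle.trans (lambdaTwo_anti hF C (hUV n))) hν ht).trans ?_
    have hsq : ∫ x, U n x ^ 2 ∂μ ≤ ∫ x, V x ^ 2 ∂μ :=
      integral_mono_of_nonneg (Eventually.of_forall fun _ => sq_nonneg _) hV.integrable_sq
        (Eventually.of_forall fun x => sq_le_sq.2 (hUV n x))
    dsimp only [B]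
    gcongr
  have hmean : Tendsto (fun n => ∫ x, U n x ∂μ) atTop (𝓝 0) :=
    hV0 ▸ (tendsto_integral_truncation (hV.integrable one_le_two)).comp
      tendsto_natCast_atTop_atTop
  have hlim : Tendsto (fun n => B (∫ x, U n x ∂μ)) atTop (𝓝 (B 0)) := by
    refine ENNReal.Tendsto.const_mul (ENNReal.tendsto_ofReal ?_) (Or.inr hν₂)
    exact (Real.continuous_exp.tendsto _).comp
      (((hmean.abs.const_mul l).const_add _).mul_const t)
  calc ∫⁻ ω, ENNReal.ofReal (Real.exp (M.additiveFunctional (fun x => l * V x) 0 t ω))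
        ∂(M.initLaw ν)
      ≤ liminf (fun n => ∫⁻ ω, ENNReal.ofReal (Real.exp
          (M.additiveFunctional (fun x => l * U n x) 0 t ω)) ∂(M.initLaw ν)) atTop :=
        MarkovProcess.lintegral_exp_additiveFunctional_le_liminf (fun n => (hU n).const_mul l)
          (fun n x => by
            simpa only [abs_mul] using mul_le_mul_of_nonneg_left (hUV n x) (abs_nonneg l))
          (fun x => (tendsto_truncation_natCast V x).const_mul l) hμ
          ((hV.integrable one_le_two).const_mul l) hν ht
    _ ≤ liminf (fun n => B (∫ x, U n x ∂μ)) atTop :=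
        liminf_le_liminf (Eventually.of_forall hbound)
    _ = B 0 := hlim.liminf_eq
    _ = _ := by simp [B]

theorem initLaw_le_of_eLpNorm_ne_top (hSob : StrongFSobolev M μ F C)
    (hμ : M.IsInvariant μ) (hF : IsContractive F) (hC : 0 < C) (hVm : Measurable V)
    (hV : MemLp V 2 μ) (hV0 : ∫ x, V x ∂μ = 0) {m : ℝ} (hm : ∫ x, V x ^ 2 ∂μ = m ^ 2)
    [IsProbabilityMeasure ν] (hν : ν ≪ μ) (hν₂ : eLpNorm (ν.rnDeriv μ) 2 μ ≠ ∞) {t : ℝ}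
    (ht : 0 < t) (R : ℝ) :
    M.initLaw ν {ω | R ≤ (1 / t) * M.additiveFunctional V 0 t ω} ≤
      eLpNorm (ν.rnDeriv μ) 2 μ *
        EReal.exp (-((t : EReal) * deviationRate (youngOf F 1) C m R (lambdaTwo F C μ V))) := by
  refine le_mul_exp_deviationRate hν₂ ht fun l hl hle => ?_
  rcases hl.eq_or_lt with rfl | hl₀
  · simpa using prob_le_one.trans (one_le_eLpNorm_rnDeriv hν)
  have hmoment :=
    hSob.lintegral_exp_additiveFunctional_le hμ hF hC hVm hV hV0 hl₀ hle hν hν₂ ht.le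
  simp only [MarkovProcess.additiveFunctional, intervalIntegral.integral_const_mul, hm] at hmoment
  have hset : {ω | R ≤ (1 / t) * M.additiveFunctional V 0 t ω} =
      {ω | R * t ≤ M.additiveFunctional V 0 t ω} := by
    simp only [one_div, inv_mul_eq_div, le_div_iff₀ ht]
  rw [hset]
  refine (measure_ge_le_mul_lintegral_exp (by fun_prop) hl (R * t)).trans
    ((mul_le_mul_left hmoment _).trans_eq ?_)
  rw [mul_assoc, ← ENNReal.ofReal_mul (Real.exp_pos _).le, ← Real.exp_add]
  ring_nf

theorem initLaw_le (hSob : StrongFSobolev M μ F C)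
    (hμ : M.IsInvariant μ) (hF : IsContractive F) (hC : 0 < C) (hVm : Measurable V)
    (hV : MemLp V 2 μ) (hV0 : ∫ x, V x ∂μ = 0) {m : ℝ} (hm : ∫ x, V x ^ 2 ∂μ = m ^ 2)
    [IsProbabilityMeasure ν] (hν : ν ≪ μ) {t : ℝ} (ht : 0 < t) (R : ℝ) :
    M.initLaw ν {ω | R ≤ (1 / t) * M.additiveFunctional V 0 t ω} ≤
      eLpNorm (ν.rnDeriv μ) 2 μ *
        EReal.exp (-((t : EReal) * deviationRate (youngOf F 1) C m R (lambdaTwo F C μ V))) := by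
  refine MarkovProcess.initLaw_le_eLpNorm_rnDeriv_mul hν ?_ fun hν₂ =>
    hSob.initLaw_le_of_eLpNorm_ne_top hμ hF hC hVm hV hV0 hm hν hν₂ ht R
  simpa only [eLpNorm_rnDeriv_self, one_mul] using hSob.initLaw_le_of_eLpNorm_ne_top hμ hF hC hVm
    hV hV0 hm Measure.AbsolutelyContinuous.rfl (eLpNorm_rnDeriv_self.trans_ne ENNReal.one_ne_top)
    ht R

end StrongFSobolev

theorem mainTheorem4_general {E Ω : Type*} [MeasurableSpace E] [MeasurableSpace Ω]
    (M : MarkovProcess E Ω) (μ : Measure E) [IsProbabilityMeasure μ] (hμ : M.IsInvariant μ)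
    (F : ℝ → ℝ) (hF : IsContractive F) (C : ℝ) (hC : 0 < C) (hSob : StrongFSobolev M μ F C)
    (V : E → ℝ) (hV : MemLp V 2 μ) (hV0 : ∫ x, V x ∂μ = 0) (m : ℝ) (hm : ∫ x, V x ^ 2 ∂μ = m ^ 2)
    (ν : Measure E) [IsProbabilityMeasure ν] (hν : ν ≪ μ) (t R : ℝ) (ht : 0 < t) :
    (∀ᵐ ω ∂(M.initLaw ν), IntervalIntegrable (fun s : ℝ => V (M.X s.toNNReal ω)) volume 0 t) ∧
      M.initLaw ν {ω | R ≤ (1 / t) * ∫ s in (0 : ℝ)..t, V (M.X s.toNNReal ω)} ≤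
        eLpNorm (ν.rnDeriv μ) 2 μ *
          EReal.exp (-((t : EReal) * deviationRate (youngOf F 1) C m R (lambdaTwo F C μ V))) := by
  have hac := (M.initLaw_absolutelyContinuous hν).ae_le
  refine ⟨hac (MarkovProcess.ae_intervalIntegrable_comp_X hμ (hV.integrable one_le_two) ht.le), ?_⟩
  obtain ⟨V', hV'm, hVV'⟩ := hV.1.aemeasurable
  have hset : {ω | R ≤ (1 / t) * ∫ s in (0 : ℝ)..t, V (M.X s.toNNReal ω)} =ᵐ[M.initLaw ν]
      {ω | R ≤ (1 / t) * M.additiveFunctional V' 0 t ω} := by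
    filter_upwards [hac (MarkovProcess.ae_additiveFunctional_eq hμ hVV' ht.le)] with ω hω
    exact congrArg (fun z : ℝ => R ≤ (1 / t) * z) hω
  have hlambda : lambdaTwo F C μ V = lambdaTwo F C μ V' := by
    simp only [lambdaTwo, gaugeNorm_congr_ae hVV']
  rw [measure_congr hset, hlambda]
  refine hSob.initLaw_le hμ hF hC hV'm (hV.ae_eq hVV') ?_ ?_ hν ht R
  · rwa [← integral_congr_ae hVV']
  · rwa [← integral_congr_ae (hVV'.fun_pow_const 2)]

theorem mainTheorem4 {E Ω : Type*} [TopologicalSpace E] [PolishSpace E] [MeasurableSpace E]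
    [BorelSpace E] [MeasurableSpace Ω] (M : MarkovProcess E Ω)
    (μ : Measure E) [IsProbabilityMeasure μ] (hμ : M.IsInvariant μ)
    (F : ℝ → ℝ) (hF : IsContractive F) (C : ℝ) (hC : 0 < C) (hSob : StrongFSobolev M μ F C)
    (V : E → ℝ) (hV : MemLp V 2 μ) (hV0 : ∫ x, V x ∂μ = 0) (m : ℝ) (hm : ∫ x, V x ^ 2 ∂μ = m ^ 2)
    (ν : Measure E) [IsProbabilityMeasure ν] (hν : ν ≪ μ) (t R : ℝ) (ht : 0 < t) (hR : 0 < R) :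
    (∀ᵐ ω ∂(M.initLaw ν), IntervalIntegrable (fun s : ℝ => V (M.X s.toNNReal ω)) volume 0 t) ∧
      M.initLaw ν {ω | R ≤ (1 / t) * ∫ s in (0 : ℝ)..t, V (M.X s.toNNReal ω)} ≤
        eLpNorm (ν.rnDeriv μ) 2 μ *
          EReal.exp (-((t : EReal) * deviationRate (youngOf F 1) C m R (lambdaTwo F C μ V))) :=
  mainTheorem4_general M μ hμ F hF C hC hSob V hV hV0 m hm ν hν t R ht
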